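/- **Theorem (multifractional Brownian motion with variable amplitude).** Let $u\in\mathbb R$ and let $U\subseteq\mathbb R$ be a closed interval with $u$ as an interior point. Let $h:U\to(0,1)$ and $a:U\to(0,\infty)$ both satisfy an $\eta$-Hölder condition on $U$ (that is, $|h(v)-h(v')|\le k|v-v'|^{\eta}$ for some constant $k$ and all $v,v'\in U$, and similarly for $a$), where $h(u)<\eta\le 1$. Let $W$ be Wiener measure (Gaussian white noise) on $\mathbb R$: a centred Gaussian family $(W(A))$, indexed by the Borel sets $A$ of finite Lebesgue measure, with $\mathbb E\,W(A)W(B)=|A\cap B|$. Put $$Y(t)=a(t)\int_{-\infty}^{\infty}\Big((t-x)_+^{h(t)-1/2}-(-x)_+^{h(t)-1/2}\Big)\,W(dx)\qquad(t\in U),$$ where the integral is the $L^2$ stochastic integral and $z_+^p=z^p$ for $z>0$, $z_+^p=0$ for $z\le0$ (also when $p\le 0$). For $0<s<1$ let $$B_s(t)=c(s)^{-1}\int_{-\infty}^{\infty}\Big((t-x)_+^{s-1/2}-(-x)_+^{s-1/2}\Big)\,W(dx)\qquad(t\in\mathbb R)$$ be index-$s$ fractional Brownian motion, where the constant $c(s)>0$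 is such that $\operatorname{Var}B_s(1)=1$, i.e. $c(s)^2=\int_{-\infty}^\infty\big((1-x)_+^{s-1/2}-(-x)_+^{s-1/2}\big)^2dx$. Then $Y$ is strongly $h(u)$-localisable at $u$ with local form $Y_u'=a(u)\,c(h(u))\,B_{h(u)}$. That is, $Y$ has a version with continuous paths on $U$, the process $Y_u'$ is non-trivial (not all $Y_u'(t)$ vanish almost surely) and has a version with continuous paths on $\mathbb R$, and for these versions $$\frac{Y(u+rt)-Y(u)}{r^{h(u)}}\longrightarrow Y_u'(t)\qquad\text{as } r\searrow0$$ in distribution in $C(\mathbb R)$ with the topology of uniform convergence on compact sets. (If $U\neq\mathbb R$, the continuous paths of $Y$ are extended continuously from $U$ to $\mathbb R$; the values off $U$ are irrelevant to the limit, since for every bounded interval of $t$ the points $u+rt$ lie in $U$ once $r$ is small.) -/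

import Mathlib

open MeasureTheory ProbabilityTheory Filter Topology
open scoped NNReal

noncomputable section

/-- The Borel `σ`-algebra of the topology of locally uniform convergence on `C(ℝ)`. -/
instance instMeasurableSpaceCReal : MeasurableSpace C(ℝ, ℝ) := borel _

instance instBorelSpaceCReal : BorelSpace C(ℝ, ℝ) := ⟨rfl⟩

/-- The Borel sets of finite Lebesgue measure on the line. -/
abbrev FiniteBorelSet : Type := {A : Set ℝ // MeasurableSet A ∧ volume A ≠ ⊤}

/-- `W` is Wiener measure (Gaussian white noise) on the line: `(W(A))`, with `A` running through
the Borel sets of finite Lebesgue measure, is a centred Gaussian family with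
`E (W(A) W(B)) = |A ∩ B|`. -/
structure IsWienerMeasure {Ω : Type*} [MeasurableSpace Ω] (P : Measure Ω)
    (W : Set ℝ → Ω → ℝ) : Prop where
  isGaussianProcess : IsGaussianProcess (fun A : FiniteBorelSet => W A.1) P
  integral_eq_zero : ∀ A : FiniteBorelSet, ∫ ω, W A.1 ω ∂P = 0
  covariance_eq : ∀ A B : FiniteBorelSet,
    ∫ ω, W A.1 ω * W B.1 ω ∂P = volume.real (A.1 ∩ B.1)

/-- The integral `∑ y, y W({s = y})` of a simple function `s`. -/
def simpleWienerIntegral {Ω : Type*} (W : Set ℝ → Ω → ℝ) (s : SimpleFunc ℝ ℝ) (ω : Ω) : ℝ :=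
  ∑ y ∈ s.range, y * W (s ⁻¹' {y}) ω

/-- The random variable `I` is a version of the stochastic integral `∫ f(x) W(dx)` of the square
integrable function `f`: it is a limit in `L²(P)` of the integrals of simple functions which
converge to `f` in `L²(ℝ)`. -/
def HasWienerIntegral {Ω : Type*} [MeasurableSpace Ω] (P : Measure Ω) (W : Set ℝ → Ω → ℝ)
    (f : ℝ → ℝ) (I : Ω → ℝ) : Prop :=
  MemLp f 2 volume ∧ MemLp I 2 P ∧
    ∃ s : ℕ → SimpleFunc ℝ ℝ, (∀ n, MemLp (s n) 2 volume) ∧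
      Tendsto (fun n => eLpNorm (fun x => f x - s n x) 2 volume) atTop (𝓝 0) ∧
      Tendsto (fun n => eLpNorm (fun ω => I ω - simpleWienerIntegral W (s n) ω) 2 P)
        atTop (𝓝 0)

open Classical in
/-- The stochastic integral `∫ f(x) W(dx)` (an arbitrarily chosen version of it). -/
def wienerIntegral {Ω : Type*} [MeasurableSpace Ω] (P : Measure Ω) (W : Set ℝ → Ω → ℝ)
    (f : ℝ → ℝ) : Ω → ℝ :=
  if H : ∃ I, HasWienerIntegral P W f I then H.choose else 0

/-- The power `x₊ ^ p` of the positive part, equal to `0` for `x ≤ 0` whatever `p` is. In particular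
`x₊ ^ 0` is the indicator function of `x > 0`. -/
def posPow (x p : ℝ) : ℝ := if 0 < x then x ^ p else 0

/-- The kernel `x ↦ (t - x)₊ ^ (h - 1/2) - (-x)₊ ^ (h - 1/2)`. For `h = 1/2` it is the
indicator function of `[0, t)` if `0 ≤ t`, and minus that of `[t, 0)` if `t < 0`. -/
def mvnKernel (h t x : ℝ) : ℝ := posPow (t - x) (h - 1 / 2) - posPow (-x) (h - 1 / 2)

/-- The normalising constant `c(h)`: the `L²` norm of the kernel at time `1`, which is the standard
deviation of its stochastic integral. -/
def fbmConst (h : ℝ) : ℝ := Real.sqrt (∫ x, mvnKernel h 1 x ^ 2)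

/-- Fractional Brownian motion of index `h`, normalised to have variance `1` at time `1`. -/
def fbm {Ω : Type*} [MeasurableSpace Ω] (P : Measure Ω) (W : Set ℝ → Ω → ℝ)
    (h t : ℝ) (ω : Ω) : ℝ :=
  (fbmConst h)⁻¹ * wienerIntegral P W (mvnKernel h t) ω

/-- Multifractional Brownian motion with index function `h` and amplitude `a`. -/
def mbm {Ω : Type*} [MeasurableSpace Ω] (P : Measure Ω) (W : Set ℝ → Ω → ℝ)
    (h a : ℝ → ℝ) (t : ℝ) (ω : Ω) : ℝ :=
  a t * wienerIntegral P W (mvnKernel (h t) t) ω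

/-- The enlargement `t ↦ (y(u + r t) - y(u)) / r ^ h` of the path `y` about `u`. -/
def enlarge (u h r : ℝ) (y : C(ℝ, ℝ)) : C(ℝ, ℝ) where
  toFun t := (y (u + r * t) - y u) / r ^ h
  continuous_toFun := by fun_prop

/-- The random element `X` of `C(ℝ)` is a version on `U` of the process `Y`. As the continuous
functions on a closed set `U` are the restrictions of those in `C(ℝ)`, a version of `Y` in `C(U)`
is described here by a random element of `C(ℝ)`, whose values off `U` are of no significance. -/
structure IsContinuousVersionOn {Ω : Type*} [MeasurableSpace Ω] (P : Measure Ω) (U : Set ℝ)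
    (Y : ℝ → Ω → ℝ) (X : Ω → C(ℝ, ℝ)) : Prop where
  measurable : Measurable X
  ae_eq : ∀ t ∈ U, (fun ω => X ω t) =ᵐ[P] Y t

/-- The process `Y` on the closed interval `U` is strongly `h`-localisable in `C(ℝ)` at the interior
point `u` of `U`, with strong local form the process `Z` on `ℝ`: the processes have continuous
versions, `Z` is not trivial, and the enlargements of `Y` about `u` converge to `Z` in distribution
as random elements of `C(ℝ)`. Enlargements on a fixed bounded interval involve only times in
`U` as soon as `r` is small. -/
def StronglyLocalisableAt {Ω Ω' : Type*} [MeasurableSpace Ω] [MeasurableSpace Ω']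
    (P : Measure Ω) [IsProbabilityMeasure P] (P' : Measure Ω') [IsProbabilityMeasure P']
    (U : Set ℝ) (Y : ℝ → Ω → ℝ) (h u : ℝ) (Z : ℝ → Ω' → ℝ) : Prop :=
  (∃ t, ¬ Z t =ᵐ[P'] 0) ∧
  ∃ (X : Ω → C(ℝ, ℝ)) (X' : Ω' → C(ℝ, ℝ)),
    IsContinuousVersionOn P U Y X ∧ IsContinuousVersionOn P' Set.univ Z X' ∧
    TendstoInDistribution (fun r ω => enlarge u h r (X ω)) (𝓝[>] (0 : ℝ)) X' (fun _ => P) P'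

end

/-! Freeze the index and the amplitude at `u`: let `Z(t) = a(u) ∫ mvnKernel (h u) t dW`. This is
`a(u) c(h(u))` times fractional Brownian motion. It is self-similar with stationary increments, so
for every `r > 0` its enlargement about `u` has exactly the law of `Z`
(`IsWienerMeasure.map_enlarge_eq`). Enlargement is linear in the path, so it is enough that the
enlargements of the error `D = Y - Z` tend to `0` in probability, uniformly on bounded intervals
(`tendstoInDistribution_add_of_map_eq`).

The white noise integral is an isometry of `L²(ℝ)` into centred Gaussian variables, so everything
about `D` can be read off its integrand `d(t)` in `L²(ℝ)`. The kernel is Lipschitz in its index,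
locally uniformly (`exists_norm_kernelL2_sub_index_le`), whence `‖d(t)‖ ≤ C |t - u| ^ η`. As `η >
h(u)`, each value of the enlarged error is small. For the supremum, increments are needed: `d` is
also locally Hölder with some possibly small exponent, and interpolating between the two bounds
gives increments of the enlargement of size `K r ^ ρ |s - t| ^ δ` with `ρ, δ > 0`
(`exists_norm_enlarge_sub_le`). Gaussian moments of high order turn this into Kolmogorov's
condition, and dyadic chaining gives the maximal inequality `exists_measure_abs_gt_le`. The same
chaining produces the continuous versions.

An interval `U` is reduced to the whole line by composing `h` and `a` with the nearest point
retraction onto `U`, which preserves the Hölder bounds. -/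

open MeasureTheory ProbabilityTheory Filter Topology
open scoped NNReal

noncomputable section

/-! ### The white noise integral as a Gaussian isometry. -/

section WienerIsometry

variable {Ω : Type*} [MeasurableSpace Ω] {P : Measure Ω}
  {W : Set ℝ → Ω → ℝ}

lemma IsWienerMeasure.memLp (hW : IsWienerMeasure P W) (A : FiniteBorelSet) :
    MemLp (W A.1) 2 P :=
  (hW.isGaussianProcess.hasGaussianLaw_eval A).memLp_two

/-- The element of `L²(ℝ)` given by the indicator function of a set of finite measure. -/
def indicatorL2 (A : FiniteBorelSet) : Lp ℝ 2 (volume : Measure ℝ) :=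
  indicatorConstLp 2 A.2.1 A.2.2 (1 : ℝ)

/-- The element of `L²(P)` given by the white noise on a set of finite measure. -/
def IsWienerMeasure.noiseL2 (hW : IsWienerMeasure P W) (A : FiniteBorelSet) : Lp ℝ 2 P :=
  (hW.memLp A).toLp _

/-- Both sides are `|A ∩ B|`. Equal Gram matrices are what allows the white noise to extend to an
isometry. -/
lemma IsWienerMeasure.inner_noiseL2 (hW : IsWienerMeasure P W) (A B : FiniteBorelSet) :
    inner ℝ (hW.noiseL2 A) (hW.noiseL2 B) = inner ℝ (indicatorL2 A) (indicatorL2 B) := by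
  have h1 : inner ℝ (hW.noiseL2 A) (hW.noiseL2 B) = volume.real (A.1 ∩ B.1) := by
    rw [← hW.covariance_eq, L2.inner_def]
    apply integral_congr_ae
    filter_upwards [(hW.memLp A).coeFn_toLp, (hW.memLp B).coeFn_toLp] with ω h1 h2
    simp only [IsWienerMeasure.noiseL2, h1, h2]
    simp [mul_comm]
  rw [h1, indicatorL2, indicatorL2,
    L2.inner_indicatorConstLp_indicatorConstLp A.2.1 B.2.1 A.2.2 B.2.2]
  simp

/-- Gram matrices determine the norms of linear combinations. -/
lemma norm_sum_smul_eq_of_inner_eq {ι E F : Type*} [NormedAddCommGroup E]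
    [InnerProductSpace ℝ E] [NormedAddCommGroup F] [InnerProductSpace ℝ F] {v : ι → E} {w : ι → F}
    (h : ∀ i j, inner ℝ (v i) (v j) = inner ℝ (w i) (w j)) (s : Finset ι) (c : ι → ℝ) :
    ‖∑ i ∈ s, c i • v i‖ = ‖∑ i ∈ s, c i • w i‖ := by
  rw [← sq_eq_sq₀ (norm_nonneg _) (norm_nonneg _), ← real_inner_self_eq_norm_sq,
    ← real_inner_self_eq_norm_sq]
  simp only [sum_inner, inner_sum, real_inner_smul_left, real_inner_smul_right, h]

lemma IsWienerMeasure.norm_linearCombination_noiseL2 (hW : IsWienerMeasure P W)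
    (c : FiniteBorelSet →₀ ℝ) : ‖Finsupp.linearCombination ℝ hW.noiseL2 c‖ =
      ‖Finsupp.linearCombination ℝ indicatorL2 c‖ :=
  norm_sum_smul_eq_of_inner_eq hW.inner_noiseL2 c.support c

lemma preimage_singleton_finiteBorel {s : SimpleFunc ℝ ℝ} (hs : MemLp s 2 volume) {y : ℝ}
    (hy : y ≠ 0) : MeasurableSet (s ⁻¹' {y}) ∧ volume (s ⁻¹' {y}) ≠ ⊤ :=
  ⟨s.measurableSet_fiber y,
    (SimpleFunc.measure_preimage_lt_top_of_memLp (by simp) (by simp) s hs y hy).ne⟩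

open Classical in
/-- The level sets of a simple function, with the values as coefficients. -/
def SimpleFunc.levelCoeff (s : SimpleFunc ℝ ℝ) (hs : MemLp s 2 volume) : FiniteBorelSet →₀ ℝ :=
  -- The level set of `0` may have infinite measure; it would carry the coefficient `0` anyway.
  ∑ y ∈ s.range, if hy : y ≠ 0 then
    Finsupp.single ⟨s ⁻¹' {y}, preimage_singleton_finiteBorel hs hy⟩ y else 0

lemma ae_eq_fun_sum {ι α : Type*} [MeasurableSpace α] {μ : Measure α} {s : Finset ι}
    {f g : ι → α → ℝ} (h : ∀ i ∈ s, f i =ᵐ[μ] g i) :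
    (fun x => ∑ i ∈ s, f i x) =ᵐ[μ] fun x => ∑ i ∈ s, g i x := by
  filter_upwards [(Finset.eventually_all s).2 h] with x hx
  exact Finset.sum_congr rfl hx

/-- General `v` and `w` serve both the indicator functions in `L²(ℝ)` and the white noise in
`L²(P)`. -/
lemma linearCombination_levelCoeff_ae_eq {α : Type*} [MeasurableSpace α] {μ : Measure α}
    {v : FiniteBorelSet → Lp ℝ 2 μ} {w : Set ℝ → α → ℝ} (h : ∀ A, v A =ᵐ[μ] w A.1)
    (s : SimpleFunc ℝ ℝ) (hs : MemLp s 2 volume) :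
    Finsupp.linearCombination ℝ v (SimpleFunc.levelCoeff s hs)
      =ᵐ[μ] fun x => ∑ y ∈ s.range, y * w (s ⁻¹' {y}) x := by
  rw [SimpleFunc.levelCoeff, map_sum]
  refine (Lp.coeFn_fun_finsetSum _ _).trans (ae_eq_fun_sum fun y _ => ?_)
  by_cases hy : y = 0
  · subst hy
    simp only [ne_eq, not_true_eq_false, dite_false, map_zero, zero_mul]
    exact Lp.coeFn_zero _ _ _
  · rw [dif_pos hy, Finsupp.linearCombination_single]
    filter_upwards [Lp.coeFn_smul y (v ⟨s ⁻¹' {y}, preimage_singleton_finiteBorel hs hy⟩),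
      h ⟨s ⁻¹' {y}, preimage_singleton_finiteBorel hs hy⟩] with x h1 h2
    rw [h1, Pi.smul_apply, h2, smul_eq_mul]

lemma linearCombination_indicatorL2_levelCoeff (s : SimpleFunc ℝ ℝ) (hs : MemLp s 2 volume) :
    Finsupp.linearCombination ℝ indicatorL2 (SimpleFunc.levelCoeff s hs) = hs.toLp s := by
  refine Lp.ext ((linearCombination_levelCoeff_ae_eq (w := fun A => A.indicator fun _ => 1)
    (fun A => indicatorConstLp_coeFn) s hs).trans (Filter.EventuallyEq.trans ?_ hs.coeFn_toLp.symm))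
  refine Eventually.of_forall fun x => ?_
  dsimp only
  rw [Finset.sum_eq_single (s x)]
  · simp
  · intro y _ hy
    rw [Set.indicator_of_notMem, mul_zero]
    simpa using hy.symm
  · exact fun h => absurd (s.mem_range_self x) h

lemma IsWienerMeasure.linearCombination_noiseL2_levelCoeff (hW : IsWienerMeasure P W)
    (s : SimpleFunc ℝ ℝ) (hs : MemLp s 2 volume) :
    Finsupp.linearCombination ℝ hW.noiseL2 (SimpleFunc.levelCoeff s hs)
      =ᵐ[P] simpleWienerIntegral W s :=
  linearCombination_levelCoeff_ae_eq (fun A => (hW.memLp A).coeFn_toLp) s hs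

lemma denseRange_linearCombination_indicatorL2 :
    DenseRange (Finsupp.linearCombination ℝ indicatorL2) := by
  apply (Lp.simpleFunc.denseRange (α := ℝ) (E := ℝ) (p := 2) (μ := volume) (by simp)).mono
  rintro _ ⟨f, rfl⟩
  have hs := Lp.simpleFunc.memLp f
  refine ⟨SimpleFunc.levelCoeff (Lp.simpleFunc.toSimpleFunc f) hs, ?_⟩
  rw [linearCombination_indicatorL2_levelCoeff]
  exact Lp.ext (hs.coeFn_toLp.trans (Lp.simpleFunc.toSimpleFunc_eq_toFun f))

/-- The white noise integral as a linear isometry from `L²(ℝ)` to `L²(P)`. -/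
def IsWienerMeasure.isometry (hW : IsWienerMeasure P W) :
    Lp ℝ 2 (volume : Measure ℝ) →L[ℝ] Lp ℝ 2 P :=
  -- Indicator functions satisfy linear relations; equality of norms forces the noise to satisfy the
  -- same ones, so the extension is consistent.
  (Finsupp.linearCombination ℝ hW.noiseL2).extendOfNorm (Finsupp.linearCombination ℝ indicatorL2)

lemma IsWienerMeasure.isometry_linearCombination (hW : IsWienerMeasure P W)
    (c : FiniteBorelSet →₀ ℝ) :
    hW.isometry (Finsupp.linearCombination ℝ indicatorL2 c) =
      Finsupp.linearCombination ℝ hW.noiseL2 c :=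
  LinearMap.extendOfNorm_eq denseRange_linearCombination_indicatorL2
    ⟨1, fun c => by rw [hW.norm_linearCombination_noiseL2, one_mul]⟩ c

lemma IsWienerMeasure.norm_isometry (hW : IsWienerMeasure P W)
    (x : Lp ℝ 2 (volume : Measure ℝ)) : ‖hW.isometry x‖ = ‖x‖ := by
  refine denseRange_linearCombination_indicatorL2.induction_on x
    (isClosed_eq (by fun_prop) (by fun_prop)) fun c => ?_
  rw [hW.isometry_linearCombination, hW.norm_linearCombination_noiseL2]

lemma IsWienerMeasure.isometry_toLp_simpleFunc (hW : IsWienerMeasure P W)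
    (s : SimpleFunc ℝ ℝ) (hs : MemLp s 2 volume) :
    hW.isometry (hs.toLp s) =ᵐ[P] simpleWienerIntegral W s := by
  rw [← linearCombination_indicatorL2_levelCoeff, hW.isometry_linearCombination]
  exact hW.linearCombination_noiseL2_levelCoeff s hs

lemma IsWienerMeasure.eLpNorm_isometry_sub (hW : IsWienerMeasure P W) {f : ℝ → ℝ}
    (hf : MemLp f 2 volume) (s : SimpleFunc ℝ ℝ) (hs : MemLp s 2 volume) :
    eLpNorm (fun ω => hW.isometry (hf.toLp f) ω - simpleWienerIntegral W s ω) 2 P =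
      eLpNorm (fun x => f x - s x) 2 volume := by
  have h1 : ‖hW.isometry (hf.toLp f) - hW.isometry (hs.toLp s)‖ = ‖hf.toLp f - hs.toLp s‖ := by
    rw [← map_sub, hW.norm_isometry]
  have h2 : (fun ω => hW.isometry (hf.toLp f) ω - simpleWienerIntegral W s ω) =ᵐ[P]
      (hW.isometry (hf.toLp f) - hW.isometry (hs.toLp s) : Lp ℝ 2 P) := by
    filter_upwards [hW.isometry_toLp_simpleFunc s hs, Lp.coeFn_sub (hW.isometry (hf.toLp f))
      (hW.isometry (hs.toLp s))] with ω h1 h2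
    rw [h2, Pi.sub_apply, h1]
  have h3 : (fun x => f x - s x) =ᵐ[volume] (hf.toLp f - hs.toLp s : Lp ℝ 2 volume) := by
    filter_upwards [hf.coeFn_toLp, hs.coeFn_toLp, Lp.coeFn_sub (hf.toLp f) (hs.toLp s)]
      with ω h1 h2 h3
    rw [h3, Pi.sub_apply, h1, h2]
  rw [eLpNorm_congr_ae h2, eLpNorm_congr_ae h3, ← ENNReal.toReal_eq_toReal_iff' (Lp.eLpNorm_ne_top _)
    (Lp.eLpNorm_ne_top _)]
  exact h1

lemma IsWienerMeasure.hasWienerIntegral_isometry (hW : IsWienerMeasure P W) {f : ℝ → ℝ}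
    (hf : MemLp f 2 volume) : HasWienerIntegral P W f (hW.isometry (hf.toLp f)) := by
  choose s hs hs' using fun n : ℕ => hf.exists_simpleFunc_eLpNorm_sub_lt (by simp)
    (ε := ((n : ENNReal) + 1)⁻¹) (by simp)
  have h0 : Tendsto (fun n => eLpNorm (fun x => f x - s n x) 2 volume) atTop (𝓝 0) := by
    refine tendsto_of_tendsto_of_tendsto_of_le_of_le tendsto_const_nhds ?_ (fun _ => zero_le)
      fun n => (hs n).le
    have := (tendsto_add_atTop_iff_nat 1).2 ENNReal.tendsto_inv_nat_nhds_zero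
    simpa using this
  refine ⟨hf, Lp.memLp _, s, hs', h0, ?_⟩
  simpa only [hW.eLpNorm_isometry_sub hf _ (hs' _)] using h0

/-- The integrals of the approximating simple functions converge in `L²(P)` both to `I` and to the
image under the isometry. Hence the arbitrary choice in `wienerIntegral` is harmless. -/
lemma IsWienerMeasure.ae_eq_isometry_of_hasWienerIntegral (hW : IsWienerMeasure P W) {f : ℝ → ℝ}
    {I : Ω → ℝ} (hI : HasWienerIntegral P W f I) : I =ᵐ[P] hW.isometry (hI.1.toLp f) := by
  obtain ⟨hf, hI2, s, hs, h1, h2⟩ := hI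
  have h3 : ∀ n, MemLp (simpleWienerIntegral W (s n)) 2 P := fun n =>
    (memLp_congr_ae (hW.isometry_toLp_simpleFunc (s n) (hs n))).1 (Lp.memLp _)
  have h4 : Tendsto (fun n => eLpNorm (I - ⇑(hW.isometry (hf.toLp f))) 2 P) (atTop : Filter ℕ) (𝓝 0) := by
    have := h2.add h1
    rw [add_zero] at this
    refine tendsto_of_tendsto_of_tendsto_of_le_of_le tendsto_const_nhds this (fun _ => zero_le)
      fun n => ?_
    dsimp only
    rw [← hW.eLpNorm_isometry_sub hf _ (hs n)]
    have e : (I - ⇑(hW.isometry (hf.toLp f)) : Ω → ℝ) =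
      (fun ω => I ω - simpleWienerIntegral W (s n) ω) -
      (fun ω => hW.isometry (hf.toLp f) ω - simpleWienerIntegral W (s n) ω) := by
      ext ω; simp
    rw [e]
    exact eLpNorm_sub_le ((hI2.sub (h3 n)).1) (((Lp.memLp _).sub (h3 n)).1) (by norm_num)
  have h5 := tendsto_nhds_unique h4 tendsto_const_nhds
  rw [eq_comm, eLpNorm_eq_zero_iff ((hI2.sub (Lp.memLp _)).1) (by norm_num)] at h5
  filter_upwards [h5] with ω h
  simpa [sub_eq_zero] using h

/-- The stochastic integral is given by the isometry. -/
lemma IsWienerMeasure.wienerIntegral_ae_eq (hW : IsWienerMeasure P W) {f : ℝ → ℝ}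
    (hf : MemLp f 2 volume) : wienerIntegral P W f =ᵐ[P] hW.isometry (hf.toLp f) := by
  have H : ∃ I, HasWienerIntegral P W f I := ⟨_, hW.hasWienerIntegral_isometry hf⟩
  rw [wienerIntegral, dif_pos H]
  exact hW.ae_eq_isometry_of_hasWienerIntegral H.choose_spec

lemma IsWienerMeasure.map_isometry_linearCombination (hW : IsWienerMeasure P W)
    (c : FiniteBorelSet →₀ ℝ) :
    P.map (hW.isometry (Finsupp.linearCombination ℝ indicatorL2 c)) =
      gaussianReal 0 (‖Finsupp.linearCombination ℝ indicatorL2 c‖₊ ^ 2) := by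
  have := hW.isGaussianProcess.isProbabilityMeasure
  set x := hW.isometry (Finsupp.linearCombination ℝ indicatorL2 c) with hx
  have h1 : (x : Ω → ℝ) =ᵐ[P] fun ω => ∑ A ∈ c.support, c A • W A.1 ω := by
    rw [hx, hW.isometry_linearCombination, Finsupp.linearCombination_apply, Finsupp.sum]
    refine (Lp.coeFn_fun_finsetSum _ _).trans (ae_eq_fun_sum fun A _ => ?_)
    filter_upwards [Lp.coeFn_smul (c A) (hW.noiseL2 A), (hW.memLp A).coeFn_toLp] with ω h2 h3
    rw [h2, Pi.smul_apply, IsWienerMeasure.noiseL2, h3]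
  have h2 : HasGaussianLaw x P :=
    ((hW.isGaussianProcess.smul c).hasGaussianLaw_fun_sum (I := c.support)).congr h1.symm
  have h3 : ∫ ω, x ω ∂P = 0 := by
    rw [integral_congr_ae h1, integral_finsetSum]
    · simp [integral_const_mul, hW.integral_eq_zero]
    · exact fun A _ => ((hW.memLp A).integrable (by norm_num)).const_mul _
  rw [h2.map_eq_gaussianReal, h3, variance_eq_sub (Lp.memLp x), h3]
  congr 1
  have h4 : ∫ ω, ((x : Ω → ℝ) ^ 2) ω ∂P = ‖x‖ ^ 2 := by
    rw [← real_inner_self_eq_norm_sq, L2.inner_def]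
    simp [pow_two]
  rw [h4, hx, hW.norm_isometry]
  ext
  simp

/-- The white noise integrals of elements of `L²(ℝ)` are centred Gaussian. -/
lemma IsWienerMeasure.map_isometry (hW : IsWienerMeasure P W)
    (x : Lp ℝ 2 (volume : Measure ℝ)) :
    P.map (hW.isometry x) = gaussianReal 0 (‖x‖₊ ^ 2) := by
  have := hW.isGaussianProcess.isProbabilityMeasure
  have hm (x) : AEMeasurable (hW.isometry x) P := (Lp.aestronglyMeasurable _).aemeasurable
  have := Measure.isProbabilityMeasure_map (hm x)
  apply Measure.ext_of_charFun
  ext ξ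
  have key (y : Lp ℝ 2 (volume : Measure ℝ)) : charFun (gaussianReal 0 (‖y‖₊ ^ 2)) ξ =
      Complex.exp (-(‖y‖ ^ 2 * ξ ^ 2 / 2 : ℝ)) := by
    rw [charFun_gaussianReal]
    congr 1
    push_cast
    simp
  rw [key]
  -- The required value of the characteristic function is a closed condition on `x`: convergence in
  -- `L²` implies convergence in measure, hence in law.
  refine denseRange_linearCombination_indicatorL2.induction_on x
    (isClosed_eq ?_ (by fun_prop)) fun c => ?_
  · refine continuous_iff_seqContinuous.2 fun y x hy => ?_
    have h1 := (tendstoInMeasure_of_tendsto_Lp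
      ((hW.isometry.continuous.tendsto x).comp hy)).tendstoInDistribution fun n => hm (y n)
    exact (ProbabilityMeasure.tendsto_iff_tendsto_charFun.1 h1.tendsto) ξ
  · rw [hW.map_isometry_linearCombination, key]

end WienerIsometry

/-! ### Norms of the kernel in `L²(ℝ)`: uniform bounds, regularity in index and time, scaling. -/

section KernelBounds

/-- A square integrable dominating function, up to translations, for the increments
`g (t - x) - g (-x)` of a function `g` with power law bounds. -/
lemma exists_memLp_increment_bound {α β T : ℝ} (hα : 0 < α) (hαβ : α ≤ β) (hβ : β < 1)
    (hT : 0 ≤ T) :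
    ∃ C : ℝ, 0 ≤ C ∧ ∀ (A : ℝ) (g : ℝ → ℝ), 0 ≤ A → Measurable g → (∀ z ≤ 0, g z = 0) →
      (∀ z, 0 < z → |g z| ≤ A * (z ^ (α - 1 / 2) + z ^ (β - 1 / 2))) →
      (∀ y z, 1 ≤ y → y ≤ z → |g z - g y| ≤ A * (z - y) * y ^ (β - 3 / 2)) →
      ∀ t ∈ Set.Icc (-T) T, MemLp (fun x => g (t - x) - g (-x)) 2 volume ∧
        ∫ x, (g (t - x) - g (-x)) ^ 2 ≤ (A * C) ^ 2 := by
  -- `A ^ 2 * q` dominates `g ^ 2` up to `2T + 1`, which covers `t - x` and `-x` as long as `-x ≤ T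
  -- + 1`. It is integrable at `0` because `2α - 1 > -1`.
  let q : ℝ → ℝ := (Set.Ioc 0 (2 * T + 1)).indicator
    fun z => 2 * z ^ (2 * α - 1) + 2 * z ^ (2 * β - 1)
  -- For `-x > T + 1` the increment is at most `A T (-T - x) ^ (β - 3/2)`, with `-T - x` below both
  -- arguments of `g`; the square is integrable because `2β - 3 < -1`.
  let m : ℝ → ℝ := (Set.Ioi 1).indicator fun z => T ^ 2 * z ^ (2 * β - 3)
  have hq : Integrable q := by
    have h1 (r : ℝ) (hr : -1 < r) : IntegrableOn (fun z : ℝ => z ^ r) (Set.Ioc 0 (2 * T + 1)) :=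
      (intervalIntegrable_iff_integrableOn_Ioc_of_le (by linarith)).1
        (intervalIntegral.intervalIntegrable_rpow' hr)
    exact (integrable_indicator_iff measurableSet_Ioc).2
      (((h1 _ (by linarith)).const_mul 2).add ((h1 _ (by linarith)).const_mul 2))
  have hm : Integrable m :=
    (integrable_indicator_iff measurableSet_Ioi).2
      ((integrableOn_Ioi_rpow_of_lt (by linarith) zero_lt_one).const_mul _)
  have hq0 : ∀ z, 0 ≤ q z := fun z => Set.indicator_nonneg
    (fun z hz => by have := hz.1.le; positivity) z
  have hm0 : ∀ z, 0 ≤ m z := fun z => Set.indicator_nonneg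
    (fun z hz => by have : (0:ℝ) ≤ z := zero_le_one.trans (le_of_lt hz); positivity) z
  have hC0 : 0 ≤ 4 * (∫ z, q z) + ∫ z, m z :=
    add_nonneg (mul_nonneg (by norm_num) (integral_nonneg hq0)) (integral_nonneg hm0)
  refine ⟨√(4 * (∫ z, q z) + ∫ z, m z), Real.sqrt_nonneg _, ?_⟩
  intro A g hA hgm hg0 hg1 hg2 t ht
  have hgq : ∀ z ≤ 2 * T + 1, g z ^ 2 ≤ A ^ 2 * q z := by
    intro z hz
    rcases le_or_gt z 0 with h0 | h0
    · rw [hg0 z h0]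
      simpa using mul_nonneg (sq_nonneg A) (hq0 z)
    · have e : q z = 2 * z ^ (2 * α - 1) + 2 * z ^ (2 * β - 1) :=
        Set.indicator_of_mem (show z ∈ Set.Ioc 0 (2 * T + 1) from ⟨h0, hz⟩) _
      have e1 (r : ℝ) : z ^ (2 * r - 1) = (z ^ (r - 1 / 2)) ^ 2 := by
        rw [← Real.rpow_natCast, ← Real.rpow_mul h0.le]
        congr 1; push_cast; ring
      rw [e, e1, e1, ← sq_abs]
      calc |g z| ^ 2 ≤ (A * (z ^ (α - 1 / 2) + z ^ (β - 1 / 2))) ^ 2 := by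
            gcongr; exact hg1 z h0
        _ ≤ _ := by
            rw [mul_pow]
            gcongr
            nlinarith [sq_nonneg (z ^ (α - 1 / 2) - z ^ (β - 1 / 2))]
  let Q : ℝ → ℝ := fun x => A ^ 2 * (2 * q (t - x) + 2 * q (-x) + m (-T - x))
  have hq' : Integrable (fun x => q (-x)) := by simpa using hq.comp_sub_left 0
  have hQ : Integrable Q := ((((hq.comp_sub_left t).const_mul 2).add
    (hq'.const_mul 2)).add (hm.comp_sub_left (-T))).const_mul _
  have hle : ∀ x, (g (t - x) - g (-x)) ^ 2 ≤ Q x := by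
    intro x
    obtain ⟨ht1, ht2⟩ := ht
    rcases le_or_gt (-x) (T + 1) with hx | hx
    · have h1 := hgq (t - x) (by linarith)
      have h2 := hgq (-x) (by linarith)
      have h3 : 0 ≤ A ^ 2 * m (-T - x) := mul_nonneg (sq_nonneg _) (hm0 _)
      simp only [Q]
      nlinarith [sq_nonneg (g (t - x) + g (-x))]
    · have h1 : |g (t - x) - g (-x)| ≤ A * T * (-T - x) ^ (β - 3 / 2) := by
        have hle' : ∀ y, -T - x ≤ y → y ^ (β - 3 / 2) ≤ (-T - x) ^ (β - 3 / 2) := fun y hy =>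
          Real.rpow_le_rpow_of_nonpos (by linarith) hy (by linarith)
        rcases le_total 0 t with h0 | h0
        · refine (hg2 (-x) (t - x) (by linarith) (by linarith)).trans ?_
          have := hle' (-x) (by linarith)
          have h5 : t - x - -x ≤ T := by linarith
          have h6 : 0 ≤ t - x - -x := by linarith
          have h7 : 0 ≤ (-x) ^ (β - 3 / 2) := Real.rpow_nonneg (by linarith) _
          gcongr
        · rw [abs_sub_comm]
          refine (hg2 (t - x) (-x) (by linarith) (by linarith)).trans ?_
          have := hle' (t - x) (by linarith)
          have h5 : -x - (t - x) ≤ T := by linarith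
          have h6 : 0 ≤ -x - (t - x) := by linarith
          have h7 : 0 ≤ (t - x) ^ (β - 3 / 2) := Real.rpow_nonneg (by linarith) _
          gcongr
      have e : m (-T - x) = T ^ 2 * (-T - x) ^ (2 * β - 3) :=
        Set.indicator_of_mem (show -T - x ∈ Set.Ioi 1 by simp only [Set.mem_Ioi]; linarith) _
      have e1 : (-T - x) ^ (2 * β - 3) = ((-T - x) ^ (β - 3 / 2)) ^ 2 := by
        rw [← Real.rpow_natCast, ← Real.rpow_mul (by linarith)]
        congr 1; push_cast; ring
      have h2 : (g (t - x) - g (-x)) ^ 2 ≤ A ^ 2 * m (-T - x) := by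
        rw [e, e1, ← sq_abs, ← mul_assoc, ← mul_pow, ← mul_pow]
        gcongr
      have h3 := mul_nonneg (sq_nonneg A) (hq0 (t - x))
      have h4 := mul_nonneg (sq_nonneg A) (hq0 (-x))
      simp only [Q]
      nlinarith
  have hmeas : Measurable fun x => g (t - x) - g (-x) :=
    (hgm.comp (measurable_const.sub measurable_id)).sub (hgm.comp measurable_neg)
  have hint : Integrable fun x => (g (t - x) - g (-x)) ^ 2 :=
    hQ.mono' (hmeas.pow_const 2).aestronglyMeasurable
      (Eventually.of_forall fun x => by
        rw [Real.norm_of_nonneg (sq_nonneg _)]; exact hle x)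
  refine ⟨(memLp_two_iff_integrable_sq hmeas.aestronglyMeasurable).2 hint, ?_⟩
  calc ∫ x, (g (t - x) - g (-x)) ^ 2 ≤ ∫ x, Q x := integral_mono hint hQ hle
    _ = A ^ 2 * (4 * (∫ z, q z) + ∫ z, m z) := by
      simp only [Q]
      rw [integral_const_mul, integral_add _ (hm.comp_sub_left (-T)), integral_add,
        integral_const_mul, integral_const_mul, integral_sub_left_eq_self q,
        integral_sub_left_eq_self m, integral_neg_eq_self q]
      · ring
      · exact (hq.comp_sub_left t).const_mul 2
      · exact hq'.const_mul 2
      · exact ((hq.comp_sub_left t).const_mul 2).add (hq'.const_mul 2)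
    _ = _ := by rw [mul_pow, Real.sq_sqrt hC0]

lemma measurable_posPow (p : ℝ) : Measurable fun x => posPow x p :=
  Measurable.ite measurableSet_Ioi (by fun_prop) measurable_const

lemma posPow_of_pos {x : ℝ} (hx : 0 < x) (p : ℝ) : posPow x p = x ^ p := if_pos hx

lemma posPow_of_nonpos {x : ℝ} (hx : x ≤ 0) (p : ℝ) : posPow x p = 0 := if_neg hx.not_gt

/-- The first power dominates for `z ≤ 1`, the second for `z ≥ 1`; this makes estimates uniform over
a range of exponents. -/
lemma rpow_le_add_rpow {z p a b : ℝ} (hz : 0 < z) (ha : a ≤ p) (hb : p ≤ b) :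
    z ^ p ≤ z ^ a + z ^ b := by
  have h1 := Real.rpow_nonneg hz.le a
  have h2 := Real.rpow_nonneg hz.le b
  rcases le_total z 1 with h | h
  · linarith [Real.rpow_le_rpow_of_exponent_ge hz h ha]
  · linarith [Real.rpow_le_rpow_of_exponent_le h hb]

lemma abs_posPow_sub_posPow_le {p b y z : ℝ} (hp : |p| ≤ 1) (hpb : p ≤ b) (hb : b < 1)
    (hy : 1 ≤ y) (hyz : y ≤ z) : |posPow z p - posPow y p| ≤ (z - y) * y ^ (b - 1) := by
  rw [posPow_of_pos (by linarith), posPow_of_pos (by linarith)]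
  have := Convex.norm_image_sub_le_of_norm_hasDerivWithin_le (f := fun x : ℝ => x ^ p)
    (f' := fun x => p * x ^ (p - 1)) (s := Set.Icc y z) (x := y) (y := z) (C := y ^ (b - 1))
    (fun x hx => (Real.hasDerivAt_rpow_const (Or.inl (by linarith [hx.1]))).hasDerivWithinAt)
    (fun x hx => ?_) (convex_Icc _ _) ⟨le_rfl, hyz⟩ ⟨hyz, le_rfl⟩
  · simp only [Real.norm_eq_abs] at this
    rw [abs_of_nonneg (sub_nonneg.2 hyz)] at this
    linarith
  · have hx0 : 0 < x := by linarith [hx.1]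
    rw [norm_mul, Real.norm_eq_abs, Real.norm_of_nonneg (Real.rpow_nonneg hx0.le _)]
    calc |p| * x ^ (p - 1) ≤ 1 * x ^ (p - 1) := by gcongr
      _ = x ^ (p - 1) := one_mul _
      _ ≤ x ^ (b - 1) := Real.rpow_le_rpow_of_exponent_le (by linarith [hx.1]) (by linarith)
      _ ≤ y ^ (b - 1) := Real.rpow_le_rpow_of_nonpos (by linarith) hx.1 (by linarith)

/-- Differentiation in the exponent produces a logarithm, which costs only an arbitrarily small
power of `z` on either side of `1`. -/
lemma rpow_mul_abs_log_le {z p a b ε : ℝ} (hz : 0 < z) (hε : 0 < ε) (ha : a ≤ p) (hb : p ≤ b) :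
    z ^ p * |Real.log z| ≤ ε⁻¹ * (z ^ (a - ε) + z ^ (b + ε)) := by
  have h1 := Real.rpow_nonneg hz.le (a - ε)
  have h2 := Real.rpow_nonneg hz.le (b + ε)
  have h0 : 0 < ε⁻¹ := inv_pos.2 hε
  rcases le_total z 1 with h | h
  · have h3 : |Real.log z| ≤ z ^ (-ε) / ε := by
      rw [abs_of_nonpos (Real.log_nonpos hz.le h), ← Real.log_inv, Real.rpow_neg hz.le,
        ← Real.inv_rpow hz.le]
      exact Real.log_le_rpow_div (inv_nonneg.2 hz.le) hε
    calc z ^ p * |Real.log z| ≤ z ^ a * (z ^ (-ε) / ε) :=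
          mul_le_mul (Real.rpow_le_rpow_of_exponent_ge hz h ha) h3 (abs_nonneg _)
            (Real.rpow_nonneg hz.le _)
      _ = ε⁻¹ * z ^ (a - ε) := by rw [sub_eq_add_neg a, Real.rpow_add hz]; ring
      _ ≤ _ := by gcongr; linarith
  · have h3 : |Real.log z| ≤ z ^ ε / ε := by
      rw [abs_of_nonneg (Real.log_nonneg h)]
      exact Real.log_le_rpow_div hz.le hε
    calc z ^ p * |Real.log z| ≤ z ^ b * (z ^ ε / ε) :=
          mul_le_mul (Real.rpow_le_rpow_of_exponent_le h hb) h3 (abs_nonneg _)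
            (Real.rpow_nonneg hz.le _)
      _ = ε⁻¹ * z ^ (b + ε) := by rw [Real.rpow_add hz]; ring
      _ ≤ _ := by gcongr; linarith

lemma abs_rpow_sub_rpow_exponent_le {z p p' a b ε : ℝ} (hz : 0 < z) (hε : 0 < ε)
    (hp : p ∈ Set.Icc a b) (hp' : p' ∈ Set.Icc a b) :
    |z ^ p - z ^ p'| ≤ ε⁻¹ * |p - p'| * (z ^ (a - ε) + z ^ (b + ε)) := by
  have := Convex.norm_image_sub_le_of_norm_hasDerivWithin_le (f := fun x : ℝ => z ^ x)
    (f' := fun x => z ^ x * Real.log z) (s := Set.Icc a b) (x := p') (y := p)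
    (C := ε⁻¹ * (z ^ (a - ε) + z ^ (b + ε)))
    (fun x hx => ((Real.hasStrictDerivAt_const_rpow hz x).hasDerivAt).hasDerivWithinAt)
    (fun x hx => ?_) (convex_Icc _ _) hp' hp
  · simp only [Real.norm_eq_abs] at this
    linarith
  · rw [norm_mul, Real.norm_of_nonneg (Real.rpow_nonneg hz.le _), Real.norm_eq_abs]
    exact rpow_mul_abs_log_le hz hε hx.1 hx.2

lemma abs_mul_rpow_sub_mul_rpow_le {x p p' b ε : ℝ} (hx : 1 ≤ x) (hε : 0 < ε)
    (hp : p ∈ Set.Icc (-1) b) (hp' : p' ∈ Set.Icc (-1) b) (hb : b ≤ 1) :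
    |p * x ^ (p - 1) - p' * x ^ (p' - 1)| ≤ (1 + ε⁻¹) * |p - p'| * x ^ (b - 1 + ε) := by
  have hx0 : 0 < x := by linarith
  have hlog := Real.log_le_rpow_div hx0.le hε
  have := Convex.norm_image_sub_le_of_norm_hasDerivWithin_le (f := fun p : ℝ => p * x ^ (p - 1))
    (f' := fun p => 1 * x ^ (p - 1) + p * (x ^ (p - 1) * Real.log x * 1))
    (s := Set.Icc (-1) b) (x := p') (y := p)
    (C := (1 + ε⁻¹) * x ^ (b - 1 + ε))
    (fun p hp => (HasDerivAt.mul (hasDerivAt_id p)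
      (((Real.hasStrictDerivAt_const_rpow hx0 (p - 1)).hasDerivAt).comp p
        ((hasDerivAt_id p).sub_const 1))).hasDerivWithinAt)
    (fun p hp => ?_) (convex_Icc _ _) hp' hp
  · simp only [Real.norm_eq_abs] at this
    linarith
  · have h1 : x ^ (p - 1) ≤ x ^ (b - 1) :=
      Real.rpow_le_rpow_of_exponent_le hx (by linarith [hp.2])
    have h2 : 0 ≤ x ^ (p - 1) := Real.rpow_nonneg hx0.le _
    have h3 : |p| ≤ 1 := abs_le.2 ⟨hp.1, hp.2.trans hb⟩
    have h4 : 0 ≤ Real.log x := Real.log_nonneg hx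
    have h5 : 1 ≤ x ^ ε := Real.one_le_rpow hx hε.le
    have h6 : 0 ≤ x ^ (b - 1) := Real.rpow_nonneg hx0.le _
    calc ‖1 * x ^ (p - 1) + p * (x ^ (p - 1) * Real.log x * 1)‖
        ≤ ‖1 * x ^ (p - 1)‖ + ‖p * (x ^ (p - 1) * Real.log x * 1)‖ := norm_add_le _ _
      _ = x ^ (p - 1) + |p| * (x ^ (p - 1) * Real.log x) := by
          rw [one_mul, mul_one, norm_mul, Real.norm_of_nonneg h2, Real.norm_eq_abs,
            Real.norm_of_nonneg (mul_nonneg h2 h4)]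
      _ ≤ x ^ (b - 1) * x ^ ε + 1 * (x ^ (b - 1) * (x ^ ε / ε)) := by
          gcongr
          calc x ^ (p - 1) ≤ x ^ (b - 1) * 1 := by rw [mul_one]; exact h1
            _ ≤ _ := by gcongr
      _ = (1 + ε⁻¹) * x ^ (b - 1 + ε) := by rw [Real.rpow_add hx0]; ring

/-- Mean value theorem twice, in `x` and then in the exponent, so that both small factors `|p - p'|`
and `z - y` survive together with the decay in `y`. -/
lemma abs_rpow_sub_increment_le {p p' b ε y z : ℝ} (hε : 0 < ε) (hy : 1 ≤ y) (hyz : y ≤ z)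
    (hp : p ∈ Set.Icc (-1) b) (hp' : p' ∈ Set.Icc (-1) b) (hb : b + ε < 1) :
    |(z ^ p - z ^ p') - (y ^ p - y ^ p')| ≤ (1 + ε⁻¹) * |p - p'| * (z - y) * y ^ (b - 1 + ε) := by
  have := Convex.norm_image_sub_le_of_norm_hasDerivWithin_le (f := fun x : ℝ => x ^ p - x ^ p')
    (f' := fun x => p * x ^ (p - 1) - p' * x ^ (p' - 1)) (s := Set.Icc y z) (x := y) (y := z)
    (C := (1 + ε⁻¹) * |p - p'| * y ^ (b - 1 + ε))
    (fun x hx => ((Real.hasDerivAt_rpow_const (Or.inl (by linarith [hx.1]))).sub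
      (Real.hasDerivAt_rpow_const (Or.inl (by linarith [hx.1])))).hasDerivWithinAt)
    (fun x hx => ?_) (convex_Icc _ _) ⟨le_rfl, hyz⟩ ⟨hyz, le_rfl⟩
  · simp only [Real.norm_eq_abs] at this
    rw [abs_of_nonneg (sub_nonneg.2 hyz)] at this
    linarith
  · refine (abs_mul_rpow_sub_mul_rpow_le (hy.trans hx.1) hε hp hp' (by linarith)).trans ?_
    gcongr ?_ * ?_
    exact Real.rpow_le_rpow_of_nonpos (by linarith) hx.1 (by linarith)

lemma memLp_mvnKernel {h : ℝ} (hh : h ∈ Set.Ioo (0 : ℝ) 1) (t : ℝ) :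
    MemLp (mvnKernel h t) 2 volume := by
  obtain ⟨C, -, hC⟩ := exists_memLp_increment_bound hh.1 le_rfl hh.2 (abs_nonneg t)
  refine (hC 1 (fun z => posPow z (h - 1 / 2)) zero_le_one (measurable_posPow _)
    (fun z hz => posPow_of_nonpos hz _) (fun z hz => ?_) (fun y z hy hyz => ?_) t
    (abs_le.1 le_rfl)).1
  · rw [posPow_of_pos hz, one_mul, abs_of_nonneg (Real.rpow_nonneg hz.le _)]
    exact rpow_le_add_rpow hz le_rfl le_rfl
  · have := abs_posPow_sub_posPow_le (p := h - 1 / 2) (b := h - 1 / 2)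
      (abs_le.2 ⟨by linarith [hh.1], by linarith [hh.2]⟩) le_rfl (by linarith [hh.2]) hy hyz
    rw [one_mul]
    convert this using 3
    ring

/-- The kernel of the moving average representation as an element of `L²(ℝ)`, for indices
in `(0, 1)`. -/
def kernelL2 (h t : ℝ) : Lp ℝ 2 (volume : Measure ℝ) :=
  if hh : h ∈ Set.Ioo (0 : ℝ) 1 then (memLp_mvnKernel hh t).toLp _ else 0

lemma kernelL2_eq {h : ℝ} (hh : h ∈ Set.Ioo (0 : ℝ) 1) (t : ℝ) :
    kernelL2 h t = (memLp_mvnKernel hh t).toLp _ := dif_pos hh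

lemma norm_toLp_eq_sqrt {f : ℝ → ℝ} (hf : MemLp f 2 volume) :
    ‖hf.toLp f‖ = √(∫ x, f x ^ 2) := by
  rw [eq_comm, Real.sqrt_eq_iff_mul_self_eq (integral_nonneg fun _ => sq_nonneg _) (norm_nonneg _),
    ← real_inner_self_eq_norm_mul_norm, L2.inner_def]
  apply integral_congr_ae
  filter_upwards [hf.coeFn_toLp] with x hx
  simp [hx, pow_two]

lemma exists_norm_kernelL2_le {α β T : ℝ} (hα : 0 < α) (hαβ : α ≤ β) (hβ : β < 1)
    (hT : 0 ≤ T) : ∃ C : ℝ, 0 ≤ C ∧ ∀ h ∈ Set.Icc α β, ∀ t ∈ Set.Icc (-T) T,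
      ‖kernelL2 h t‖ ≤ C := by
  obtain ⟨C, hC0, hC⟩ := exists_memLp_increment_bound hα hαβ hβ hT
  refine ⟨C, hC0, fun h hh t ht => ?_⟩
  have hh' : h ∈ Set.Ioo (0 : ℝ) 1 := ⟨by linarith [hh.1], by linarith [hh.2]⟩
  rw [kernelL2_eq hh', norm_toLp_eq_sqrt]
  refine Real.sqrt_le_iff.2 ⟨hC0, ?_⟩
  rw [← one_mul C]
  refine (hC 1 (fun z => posPow z (h - 1 / 2)) zero_le_one (measurable_posPow _)
    (fun z hz => posPow_of_nonpos hz _) (fun z hz => ?_) (fun y z hy hyz => ?_) t ht).2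
  · rw [posPow_of_pos hz, one_mul, abs_of_nonneg (Real.rpow_nonneg hz.le _)]
    exact rpow_le_add_rpow hz (by linarith [hh.1]) (by linarith [hh.2])
  · have := abs_posPow_sub_posPow_le (p := h - 1 / 2) (b := β - 1 / 2)
      (abs_le.2 ⟨by linarith [hh'.1], by linarith [hh'.2]⟩) (by linarith [hh.2]) (by linarith) hy hyz
    rw [one_mul]
    convert this using 3
    ring

/-- The general increment bound is applied to a difference of two powers, whose size constant `A` is
a multiple of `|h - h'|`. -/
lemma exists_norm_kernelL2_sub_index_le {α β T : ℝ} (hα : 0 < α) (hαβ : α ≤ β) (hβ : β < 1)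
    (hT : 0 ≤ T) : ∃ C : ℝ, 0 ≤ C ∧ ∀ h ∈ Set.Icc α β, ∀ h' ∈ Set.Icc α β, ∀ t ∈ Set.Icc (-T) T,
      ‖kernelL2 h t - kernelL2 h' t‖ ≤ C * |h - h'| := by
  -- The logarithms widen the range of indices by `ε`; it must remain inside `(0, 1)`.
  obtain ⟨ε, hε, h1, h2⟩ : ∃ ε : ℝ, 0 < ε ∧ 0 < α - ε ∧ β + ε < 1 :=
    ⟨min (α / 2) ((1 - β) / 2), lt_min (by linarith) (by linarith),
      by linarith [min_le_left (α / 2) ((1 - β) / 2)],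
      by linarith [min_le_right (α / 2) ((1 - β) / 2)]⟩
  have hε' : 0 < ε⁻¹ := inv_pos.2 hε
  obtain ⟨C, hC0, hC⟩ := exists_memLp_increment_bound h1 (by linarith) h2 hT
  refine ⟨(1 + ε⁻¹) * C, by positivity, fun h hh h' hh' t ht => ?_⟩
  rw [kernelL2_eq ⟨by linarith [hh.1], by linarith [hh.2]⟩,
    kernelL2_eq ⟨by linarith [hh'.1], by linarith [hh'.2]⟩, ← MemLp.toLp_sub, norm_toLp_eq_sqrt]
  refine Real.sqrt_le_iff.2 ⟨by positivity, ?_⟩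
  have hd : h - 1 / 2 - (h' - 1 / 2) = h - h' := by ring
  have := (hC ((1 + ε⁻¹) * |h - h'|) (fun z => posPow z (h - 1 / 2) - posPow z (h' - 1 / 2))
    (by positivity) ((measurable_posPow _).sub (measurable_posPow _))
    (fun z hz => by simp [posPow_of_nonpos hz]) (fun z hz => ?_) (fun y z hy hyz => ?_) t ht).2
  · calc _ = _ := ?_
      _ ≤ _ := this
      _ = _ := by ring
    congr 1 with x
    simp only [Pi.sub_apply, mvnKernel]
    ring
  · rw [posPow_of_pos hz, posPow_of_pos hz]
    refine (abs_rpow_sub_rpow_exponent_le (a := α - 1 / 2) (b := β - 1 / 2) hz hε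
      ⟨by linarith [hh.1], by linarith [hh.2]⟩ ⟨by linarith [hh'.1], by linarith [hh'.2]⟩).trans ?_
    rw [hd, show α - 1 / 2 - ε = α - ε - 1 / 2 by ring, show β - 1 / 2 + ε = β + ε - 1 / 2 by ring]
    have := Real.rpow_nonneg hz.le (α - ε - 1 / 2)
    have := Real.rpow_nonneg hz.le (β + ε - 1 / 2)
    gcongr
    linarith
  · rw [posPow_of_pos (by linarith), posPow_of_pos (by linarith), posPow_of_pos (by linarith),
      posPow_of_pos (by linarith)]
    refine (abs_rpow_sub_increment_le (b := β - 1 / 2) hε hy hyz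
      ⟨by linarith [hh.1], by linarith [hh.2]⟩ ⟨by linarith [hh'.1], by linarith [hh'.2]⟩
      (by linarith)).trans_eq ?_
    rw [hd]
    congr 2
    ring

lemma posPow_mul {r : ℝ} (hr : 0 < r) (z p : ℝ) : posPow (r * z) p = r ^ p * posPow z p := by
  rcases le_or_gt z 0 with hz | hz
  · rw [posPow_of_nonpos hz, posPow_of_nonpos (mul_nonpos_of_nonneg_of_nonpos hr.le hz), mul_zero]
  · rw [posPow_of_pos hz, posPow_of_pos (mul_pos hr hz), Real.mul_rpow hr.le hz.le]

lemma mvnKernel_mul {r : ℝ} (hr : 0 < r) (h t x : ℝ) :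
    mvnKernel h (r * t) (r * x) = r ^ (h - 1 / 2) * mvnKernel h t x := by
  rw [mvnKernel, mvnKernel, ← mul_sub, ← mul_neg, posPow_mul hr, posPow_mul hr, mul_sub]

/-- Translation by `s` gives stationary increments. The substitution `x ↦ (t - s) x` then extracts
`(t - s) ^ (2h - 1)` from the squared kernel and `t - s` from the Jacobian. -/
lemma integral_mvnKernel_sub_sq (h : ℝ) {s t : ℝ} (hst : s < t) :
    ∫ x, (mvnKernel h t x - mvnKernel h s x) ^ 2 =
      (t - s) ^ (2 * h) * ∫ x, mvnKernel h 1 x ^ 2 := by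
  have hr : 0 < t - s := sub_pos.2 hst
  have h1 : ∀ x, (mvnKernel h t x - mvnKernel h s x) ^ 2 =
      (fun x => mvnKernel h (t - s) x ^ 2) (x - s) := by
    intro x
    simp only [mvnKernel]
    rw [show t - s - (x - s) = t - x by ring, show -(x - s) = s - x by ring]
    ring
  simp_rw [h1]
  rw [integral_sub_right_eq_self (fun x => mvnKernel h (t - s) x ^ 2)]
  have h2 := Measure.integral_comp_mul_left (fun x => mvnKernel h (t - s) x ^ 2) (t - s)
  have h3 : ∀ x, mvnKernel h (t - s) ((t - s) * x) = (t - s) ^ (h - 1 / 2) * mvnKernel h 1 x := by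
    intro x
    rw [← mvnKernel_mul hr, mul_one]
  simp_rw [h3, mul_pow] at h2
  rw [integral_const_mul, smul_eq_mul, abs_of_pos (inv_pos.2 hr), eq_inv_mul_iff_mul_eq₀ hr.ne']
    at h2
  rw [← h2, ← mul_assoc]
  congr 1
  rw [← Real.rpow_natCast, ← Real.rpow_mul hr.le, show 2 * h = 1 + (h - 1 / 2) * (2 : ℕ) by
    push_cast; ring, Real.rpow_add hr, Real.rpow_one]

lemma kernelL2_zero_right (h : ℝ) : kernelL2 h 0 = 0 := by
  rw [kernelL2]
  split_ifs with hh
  · rw [Lp.eq_zero_iff_ae_eq_zero]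
    refine (memLp_mvnKernel hh 0).coeFn_toLp.trans ?_
    exact Eventually.of_forall fun x => by simp [mvnKernel]
  · rfl

lemma norm_kernelL2_one {h : ℝ} (hh : h ∈ Set.Ioo (0 : ℝ) 1) : ‖kernelL2 h 1‖ = fbmConst h := by
  rw [kernelL2_eq hh, norm_toLp_eq_sqrt, fbmConst]

lemma norm_kernelL2_sub {h : ℝ} (hh : h ∈ Set.Ioo (0 : ℝ) 1) (t s : ℝ) :
    ‖kernelL2 h t - kernelL2 h s‖ = |t - s| ^ h * fbmConst h := by
  wlog hst : s < t generalizing s t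
  · rcases eq_or_lt_of_le (not_lt.1 hst) with rfl | hst
    · simp [Real.zero_rpow hh.1.ne']
    · rw [norm_sub_rev, abs_sub_comm, this s t hst]
  have hr : 0 < t - s := sub_pos.2 hst
  rw [kernelL2_eq hh, kernelL2_eq hh, ← MemLp.toLp_sub, norm_toLp_eq_sqrt]
  simp only [Pi.sub_apply]
  rw [integral_mvnKernel_sub_sq h hst, fbmConst, abs_of_pos hr, Real.sqrt_mul (by positivity)]
  congr 1
  rw [mul_comm 2 h, Real.rpow_mul hr.le, Real.rpow_two, Real.sqrt_sq (by positivity)]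

/-- On `(0, 1)` the kernel at time `1` is `(1 - x) ^ (h - 1/2) > 0`. -/
lemma fbmConst_pos {h : ℝ} (hh : h ∈ Set.Ioo (0 : ℝ) 1) : 0 < fbmConst h := by
  rw [← norm_kernelL2_one hh, norm_pos_iff, kernelL2_eq hh]
  intro h0
  rw [Lp.eq_zero_iff_ae_eq_zero] at h0
  replace h0 := (memLp_mvnKernel hh 1).coeFn_toLp.symm.trans h0
  have h1 : ∀ᵐ x ∂(volume : Measure ℝ), x ∉ Set.Ioo (0 : ℝ) 1 := by
    filter_upwards [h0] with x hx hx'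
    simp only [mvnKernel, Pi.zero_apply] at hx
    rw [posPow_of_pos (by linarith [hx'.2]), posPow_of_nonpos (by linarith [hx'.1]), sub_zero] at hx
    exact (Real.rpow_pos_of_pos (by linarith [hx'.2]) _).ne' hx
  have h2 : volume (Set.Ioo (0 : ℝ) 1) = 0 :=
    measure_eq_zero_iff_ae_notMem.2 h1
  simp at h2

end KernelBounds

/-! ### Measurability and laws on `C(ℝ)`. -/

section ContinuousPaths

/-- A random element of `C(ℝ)` is measurable if its evaluations are. -/
lemma measurable_of_measurable_eval {Ω : Type*} [MeasurableSpace Ω] {X : Ω → C(ℝ, ℝ)}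
    (hX : ∀ t, Measurable fun ω => X ω t) : Measurable X := by
  have hb : borel C(ℝ, ℝ) = _ := borel_eq_generateFrom_of_subbasis ContinuousMap.compactOpen_eq
  rw [show instMeasurableSpaceCReal = borel C(ℝ, ℝ) from rfl, hb]
  refine measurable_generateFrom ?_
  rintro _ ⟨K, hK, V, hV, rfl⟩
  rcases K.eq_empty_or_nonempty with rfl | hne
  · have : X ⁻¹' {f : C(ℝ, ℝ) | Set.MapsTo f ∅ V} = Set.univ :=
      Set.eq_univ_of_forall fun ω => Set.mapsTo_empty _ _
    rw [this]
    exact MeasurableSet.univ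
  obtain ⟨D, hDK, hDc, hKD⟩ := (TopologicalSpace.IsSeparable.of_separableSpace K).exists_countable_dense_subset
  -- By compactness `f` keeps `K` at a positive distance from the complement of `V`, and by
  -- continuity a lower bound for the distance need only be tested on the countable set `D`.
  have key : ∀ f : C(ℝ, ℝ), Set.MapsTo f K V ↔
      ∃ n : ℕ, ∀ x ∈ D, (n : ENNReal)⁻¹ ≤ Metric.infEDist (f x) Vᶜ := by
    intro f
    have hc : Continuous fun x => Metric.infEDist (f x) Vᶜ :=
      Metric.continuous_infEDist.comp f.continuous
    constructor
    · intro h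
      obtain ⟨x, hx, hmin⟩ := hK.exists_isMinOn hne hc.continuousOn
      have hpos : Metric.infEDist (f x) Vᶜ ≠ 0 := fun h0 =>
        (Metric.mem_iff_infEDist_zero_of_closed (show IsOpen V from hV).isClosed_compl).2 h0 (h hx)
      obtain ⟨n, hn⟩ := ENNReal.exists_inv_nat_lt hpos
      exact ⟨n, fun y hy => hn.le.trans (hmin (hDK hy))⟩
    · rintro ⟨n, hn⟩ x hx
      have h1 : (n : ENNReal)⁻¹ ≤ Metric.infEDist (f x) Vᶜ := by
        have hcl : IsClosed {x | (n : ENNReal)⁻¹ ≤ Metric.infEDist (f x) Vᶜ} :=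
          isClosed_le continuous_const hc
        exact hcl.closure_subset_iff.2 hn (hKD hx)
      by_contra hxV
      rw [Metric.infEDist_zero_of_mem (Set.mem_compl hxV)] at h1
      simp at h1
  have e : X ⁻¹' {f : C(ℝ, ℝ) | Set.MapsTo f K V} =
      ⋃ n : ℕ, ⋂ x ∈ D, {ω | (n : ENNReal)⁻¹ ≤ Metric.infEDist (X ω x) Vᶜ} := by
    ext ω
    simp [key]
  rw [e]
  refine MeasurableSet.iUnion fun n => MeasurableSet.biInter hDc fun x _ => ?_
  exact measurableSet_le measurable_const
    (Metric.continuous_infEDist.measurable.comp (hX x))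

lemma measurable_eval_CReal (t : ℝ) : Measurable fun f : C(ℝ, ℝ) => f t :=
  (continuous_eval_const t).measurable

/-- Transfers equality of laws from the product space, where finite-dimensional distributions
decide, to `C(ℝ)`. -/
lemma comap_coe_pi_eq :
    MeasurableSpace.comap (fun (f : C(ℝ, ℝ)) (t : ℝ) => f t) MeasurableSpace.pi =
      instMeasurableSpaceCReal := by
  apply le_antisymm
  · exact (measurable_pi_lambda _ measurable_eval_CReal).comap_le
  · have : @Measurable _ _ (MeasurableSpace.comap (fun (f : C(ℝ, ℝ)) (t : ℝ) => f t)
      MeasurableSpace.pi) _ (id : C(ℝ, ℝ) → C(ℝ, ℝ)) :=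
      @measurable_of_measurable_eval _ (MeasurableSpace.comap
        (fun (f : C(ℝ, ℝ)) (t : ℝ) => f t) MeasurableSpace.pi) id
        fun t => (measurable_pi_apply t).comp (comap_measurable _)
    exact fun s hs => this hs

/-- The law of a random element of `C(ℝ)` is determined by its finite-dimensional
distributions. -/
lemma map_eq_of_forall_finset {Ω : Type*} [MeasurableSpace Ω] {P : Measure Ω} [IsFiniteMeasure P]
    {X Y : Ω → C(ℝ, ℝ)} (hX : Measurable X) (hY : Measurable Y)
    (h : ∀ I : Finset ℝ, P.map (fun ω => I.restrict fun t => X ω t) =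
      P.map (fun ω => I.restrict fun t => Y ω t)) : P.map X = P.map Y := by
  have mX : Measurable fun ω (t : ℝ) => X ω t :=
    measurable_pi_lambda _ fun t => (measurable_eval_CReal t).comp hX
  have mY : Measurable fun ω (t : ℝ) => Y ω t :=
    measurable_pi_lambda _ fun t => (measurable_eval_CReal t).comp hY
  have h1 := (map_eq_iff_forall_finset_map_restrict_eq (P := P) (X := fun t ω => X ω t)
    (Y := fun t ω => Y ω t) mX.aemeasurable mY.aemeasurable).2 h
  ext s hs
  rw [Measure.map_apply hX hs, Measure.map_apply hY hs]
  rw [← comap_coe_pi_eq] at hs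
  obtain ⟨B, hB, rfl⟩ := hs
  have h2 := congrArg (fun μ => μ B) h1
  rwa [Measure.map_apply mX hB, Measure.map_apply mY hB] at h2

end ContinuousPaths

/-! ### Deterministic dyadic chaining. -/

section Dyadic

/-- The largest dyadic number of level `n` which is at most `t`. -/
def dyadicFloor (n : ℕ) (t : ℝ) : ℝ := ⌊2 ^ n * t⌋ / 2 ^ n

/-- The increments of `f` between neighbouring dyadic numbers of level `n` in `[-M, M]` are at most
`A * b ^ n`, for every `n`. -/
def DyadicIncrementsLE (f : ℝ → ℝ) (M : ℕ) (A b : ℝ) : Prop :=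
  ∀ n : ℕ, ∀ k ∈ Finset.Ico (-(M * 2 ^ n : ℤ)) (M * 2 ^ n),
    |f ((k + 1) / 2 ^ n) - f (k / 2 ^ n)| ≤ A * b ^ n

variable {f : ℝ → ℝ} {M : ℕ} {A b : ℝ}

lemma dyadicFloor_le (n : ℕ) (t : ℝ) : dyadicFloor n t ≤ t := by
  rw [dyadicFloor, div_le_iff₀ (by positivity), mul_comm]
  exact Int.floor_le _

lemma lt_dyadicFloor_add (n : ℕ) (t : ℝ) : t < dyadicFloor n t + (2 ^ n)⁻¹ := by
  have := Int.lt_floor_add_one (2 ^ n * t)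
  rw [dyadicFloor, ← one_div, ← add_div, lt_div_iff₀ (by positivity), mul_comm]
  exact this

lemma tendsto_dyadicFloor (t : ℝ) : Tendsto (fun n => dyadicFloor n t) atTop (𝓝 t) := by
  have h : Tendsto (fun n : ℕ => t - ((2 : ℝ)⁻¹) ^ n) atTop (𝓝 (t - 0)) :=
    tendsto_const_nhds.sub (tendsto_pow_atTop_nhds_zero_of_lt_one (by norm_num) (by norm_num))
  rw [sub_zero] at h
  refine tendsto_of_tendsto_of_tendsto_of_le_of_le h tendsto_const_nhds (fun n => ?_)
    fun n => dyadicFloor_le n t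
  have := lt_dyadicFloor_add n t
  simp only [inv_pow]
  linarith

/-- The interval is half-open so that the dyadic cell to the right of the floor still lies in `[-M,
M]`. -/
lemma floor_mem_Ico {t : ℝ} (ht : t ∈ Set.Ico (-(M : ℝ)) M) (n : ℕ) :
    ⌊2 ^ n * t⌋ ∈ Finset.Ico (-(M * 2 ^ n : ℤ)) (M * 2 ^ n) := by
  have h2 : (0 : ℝ) < 2 ^ n := by positivity
  rw [Finset.mem_Ico, Int.le_floor, Int.floor_lt]
  push_cast
  constructor <;> nlinarith [ht.1, ht.2]

/-- On refining the level by one, the dyadic floor either stays put or moves right by a single step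
of the finer grid. -/
lemma DyadicIncrementsLE.abs_succ_sub_le (h : DyadicIncrementsLE f M A b) (hA : 0 ≤ A)
    (hb : 0 ≤ b) {t : ℝ} (ht : t ∈ Set.Ico (-(M : ℝ)) M) (n : ℕ) :
    |f (dyadicFloor n t) - f (dyadicFloor (n + 1) t)| ≤ A * b ^ (n + 1) := by
  set k := ⌊(2 : ℝ) ^ n * t⌋ with hk
  have h1 := Int.floor_le ((2 : ℝ) ^ n * t)
  have h2 := Int.lt_floor_add_one ((2 : ℝ) ^ n * t)
  rw [← hk] at h1 h2
  have hpos : (2 : ℝ) ^ n ≠ 0 := by positivity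
  have hk1 : dyadicFloor n t = (2 * k : ℤ) / 2 ^ (n + 1) := by
    rw [dyadicFloor, ← hk, pow_succ]
    push_cast
    field_simp
  rcases lt_or_ge ((2 : ℝ) ^ (n + 1) * t) (2 * k + 1) with h3 | h3
  · have : ⌊(2 : ℝ) ^ (n + 1) * t⌋ = 2 * k := by
      rw [Int.floor_eq_iff]
      push_cast
      constructor
      · rw [pow_succ]; linarith
      · exact h3
    rw [hk1, dyadicFloor, this, sub_self, abs_zero]
    positivity
  · have hfl : ⌊(2 : ℝ) ^ (n + 1) * t⌋ = 2 * k + 1 := by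
      rw [Int.floor_eq_iff]
      push_cast
      constructor
      · exact h3
      · rw [pow_succ]; linarith
    have hm := floor_mem_Ico ht n
    have hm' := floor_mem_Ico ht (n + 1)
    rw [← hk] at hm
    rw [hfl] at hm'
    have := h (n + 1) (2 * k) (by
      rw [Finset.mem_Ico] at hm hm' ⊢
      constructor
      · rw [pow_succ]; linarith
      · linarith)
    rw [hk1, dyadicFloor, hfl, abs_sub_comm]
    push_cast at this ⊢
    exact this

/-- At distance at most `2 ^ (-n)` the two floors of level `n` coincide or are neighbours. -/
lemma DyadicIncrementsLE.abs_sub_le (h : DyadicIncrementsLE f M A b) (hA : 0 ≤ A)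
    (hb : 0 ≤ b) {s t : ℝ} (hs : s ∈ Set.Ico (-(M : ℝ)) M) (ht : t ∈ Set.Ico (-(M : ℝ)) M)
    {n : ℕ} (hst : |s - t| ≤ (2 ^ n)⁻¹) :
    |f (dyadicFloor n s) - f (dyadicFloor n t)| ≤ A * b ^ n := by
  wlog hle : s ≤ t generalizing s t
  · rw [abs_sub_comm]
    exact this ht hs (by rwa [abs_sub_comm]) (le_of_not_ge hle)
  have hpos : (0 : ℝ) < 2 ^ n := by positivity
  set k := ⌊(2 : ℝ) ^ n * s⌋ with hk
  have h1 : k ≤ ⌊(2 : ℝ) ^ n * t⌋ := Int.floor_le_floor (by gcongr)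
  have h2 : ⌊(2 : ℝ) ^ n * t⌋ ≤ k + 1 := by
    rw [abs_sub_comm, abs_of_nonneg (by linarith), ← one_div, le_div_iff₀ hpos] at hst
    rw [← Int.lt_add_one_iff, Int.floor_lt]
    have := Int.lt_floor_add_one ((2 : ℝ) ^ n * s)
    rw [← hk] at this
    push_cast
    nlinarith
  rcases h1.eq_or_lt with h3 | h3
  · rw [dyadicFloor, dyadicFloor, ← h3, ← hk, sub_self, abs_zero]
    positivity
  · have h4 : ⌊(2 : ℝ) ^ n * t⌋ = k + 1 := by omega
    rw [dyadicFloor, dyadicFloor, h4, ← hk, abs_sub_comm]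
    push_cast
    exact h n k (floor_mem_Ico hs n)

lemma DyadicIncrementsLE.exists_tendsto (h : DyadicIncrementsLE f M A b) (hA : 0 ≤ A)
    (hb : 0 ≤ b) (hb1 : b < 1) {t : ℝ} (ht : t ∈ Set.Ico (-(M : ℝ)) M) :
    ∃ l, Tendsto (fun n => f (dyadicFloor n t)) atTop (𝓝 l) := by
  apply cauchySeq_tendsto_of_complete
  refine cauchySeq_of_le_geometric b (A * b) hb1 fun n => ?_
  rw [Real.dist_eq]
  exact (h.abs_succ_sub_le hA hb ht n).trans_eq (by ring)

lemma DyadicIncrementsLE.abs_sub_limit_le (h : DyadicIncrementsLE f M A b) (hA : 0 ≤ A)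
    (hb : 0 ≤ b) (hb1 : b < 1) {t l : ℝ} (ht : t ∈ Set.Ico (-(M : ℝ)) M)
    (hl : Tendsto (fun n => f (dyadicFloor n t)) atTop (𝓝 l)) (n : ℕ) :
    |f (dyadicFloor n t) - l| ≤ A * b * b ^ n / (1 - b) := by
  refine dist_le_of_le_geometric_of_tendsto b (A * b) hb1 (fun n => ?_) hl n
  rw [Real.dist_eq]
  exact (h.abs_succ_sub_le hA hb ht n).trans_eq (by ring)

lemma DyadicIncrementsLE.abs_limit_sub_limit_le (h : DyadicIncrementsLE f M A b) (hA : 0 ≤ A)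
    (hb : 0 ≤ b) (hb1 : b < 1) {l : ℝ → ℝ}
    (hl : ∀ t ∈ Set.Ico (-(M : ℝ)) M, Tendsto (fun n => f (dyadicFloor n t)) atTop (𝓝 (l t)))
    {s t : ℝ} (hs : s ∈ Set.Ico (-(M : ℝ)) M) (ht : t ∈ Set.Ico (-(M : ℝ)) M)
    {n : ℕ} (hst : |s - t| ≤ (2 ^ n)⁻¹) :
    |l s - l t| ≤ (A + 2 * (A * b / (1 - b))) * b ^ n := by
  have h1 := h.abs_sub_limit_le hA hb hb1 hs (hl s hs) n
  have h2 := h.abs_sub_limit_le hA hb hb1 ht (hl t ht) n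
  have h3 := h.abs_sub_le hA hb hs ht hst
  have e : (A + 2 * (A * b / (1 - b))) * b ^ n = A * b ^ n + 2 * (A * b * b ^ n / (1 - b)) := by
    ring
  rw [e]
  rw [abs_le] at *
  constructor <;> linarith [h1.1, h1.2, h2.1, h2.2, h3.1, h3.2]

/-- If the dyadic increments decay geometrically on every bounded interval, the limits along the
dyadic approximations define a continuous function. -/
lemma exists_continuousMap_of_dyadicIncrementsLE {b : ℕ → ℝ} (hb : ∀ M, 0 ≤ b M)
    (hb1 : ∀ M, b M < 1) (h : ∀ M : ℕ, ∃ A : ℕ, DyadicIncrementsLE f M A (b M)) :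
    ∃ g : C(ℝ, ℝ), ∀ t, Tendsto (fun n => f (dyadicFloor n t)) atTop (𝓝 (g t)) := by
  have hM (t : ℝ) : ∃ M : ℕ, t ∈ Set.Ioo (-(M : ℝ)) M := by
    obtain ⟨M, hM⟩ := exists_nat_gt |t|
    exact ⟨M, abs_lt.1 hM⟩
  have h1 (t : ℝ) : ∃ l, Tendsto (fun n => f (dyadicFloor n t)) atTop (𝓝 l) := by
    obtain ⟨M, hM⟩ := hM t
    obtain ⟨A, hA⟩ := h M
    exact hA.exists_tendsto A.cast_nonneg (hb M) (hb1 M) ⟨hM.1.le, hM.2⟩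
  choose l hl using h1
  refine ⟨⟨l, continuous_iff_continuousAt.2 fun t => ?_⟩, hl⟩
  obtain ⟨M, hM⟩ := hM t
  obtain ⟨A, hA⟩ := h M
  set C := (A + 2 * (A * b M / (1 - b M))) with hC
  rw [Metric.continuousAt_iff']
  intro ε hε
  have h2 : Tendsto (fun n => C * b M ^ n) atTop (𝓝 (C * 0)) :=
    (tendsto_pow_atTop_nhds_zero_of_lt_one (hb M) (hb1 M)).const_mul C
  rw [mul_zero] at h2
  obtain ⟨n, hn⟩ := (h2.eventually_lt_const hε).exists
  filter_upwards [Ioo_mem_nhds hM.1 hM.2,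
    Metric.closedBall_mem_nhds t (show (0 : ℝ) < (2 ^ n)⁻¹ by positivity)] with s hs hst
  rw [Real.dist_eq]
  rw [Metric.mem_closedBall, Real.dist_eq] at hst
  exact (hA.abs_limit_sub_limit_le A.cast_nonneg (hb M) (hb1 M) (fun t _ => hl t)
    ⟨hs.1.le, hs.2⟩ ⟨hM.1.le, hM.2⟩ hst).trans_lt hn

lemma DyadicIncrementsLE.abs_natCast_le (h : DyadicIncrementsLE f M A b) (h0 : f 0 = 0)
    (i : ℕ) (hi : i ≤ M) : |f i| ≤ i * A ∧ |f (-i)| ≤ i * A := by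
  induction i with
  | zero => simp [h0]
  | succ i ih =>
    obtain ⟨h1, h2⟩ := ih (by omega)
    have h3 := h 0 i (by simp only [pow_zero, mul_one, Finset.mem_Ico]; omega)
    have h4 := h 0 (-(i + 1)) (by simp only [pow_zero, mul_one, Finset.mem_Ico]; omega)
    push_cast at h3 h4 ⊢
    simp only [pow_zero, mul_one, div_one] at h3 h4
    rw [show -((i : ℝ) + 1) + 1 = -i by ring] at h4
    rw [abs_le] at h1 h2 h3 h4 ⊢
    rw [abs_le]
    constructor <;> constructor <;> linarith [h1.1, h1.2, h2.1, h2.2, h3.1, h3.2, h4.1, h4.2]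

lemma DyadicIncrementsLE.abs_intCast_le (h : DyadicIncrementsLE f M A b) (hA : 0 ≤ A)
    (h0 : f 0 = 0) (k : ℤ) (hk : |k| ≤ M) : |f k| ≤ M * A := by
  obtain ⟨i, rfl | rfl⟩ := Int.eq_nat_or_neg k
  · have hi : i ≤ M := by simpa using hk
    push_cast
    exact (h.abs_natCast_le h0 i hi).1.trans (by gcongr)
  · have hi : i ≤ M := by simpa using hk
    push_cast
    exact (h.abs_natCast_le h0 i hi).2.trans (by gcongr)

/-- The supremum of a continuous function is controlled by its dyadic increments. -/
lemma DyadicIncrementsLE.abs_le_of_continuous (h : DyadicIncrementsLE f M A b) (hA : 0 ≤ A)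
    (hb : 0 ≤ b) (hb1 : b < 1) (hf : Continuous f) (h0 : f 0 = 0) {t : ℝ}
    (ht : t ∈ Set.Ico (-(M : ℝ)) M) : |f t| ≤ A * (M + b / (1 - b)) := by
  have h1 := h.abs_sub_limit_le hA hb hb1 ht ((hf.tendsto t).comp (tendsto_dyadicFloor t)) 0
  have e : dyadicFloor 0 t = (⌊t⌋ : ℤ) := by simp [dyadicFloor]
  have h3 := floor_mem_Ico ht 0
  simp only [pow_zero, one_mul, mul_one, Finset.mem_Ico] at h3
  have h4 : |⌊t⌋| ≤ M := abs_le.2 ⟨h3.1, h3.2.le⟩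
  have h2 := h.abs_intCast_le hA h0 ⌊t⌋ h4
  rw [e, pow_zero, mul_one] at h1
  calc |f t| = |f ⌊t⌋ - (f ⌊t⌋ - f t)| := by congr 1; ring
    _ ≤ |f ⌊t⌋| + |f ⌊t⌋ - f t| := abs_sub _ _
    _ ≤ M * A + A * b / (1 - b) := add_le_add h2 h1
    _ = _ := by ring

end Dyadic

/-! ### Kolmogorov's continuity criterion and a maximal inequality. -/

section Kolmogorov

/-- The ratio of the dyadic increment bounds in the continuity criterion with exponent `p`. -/
def kolmogorovRatio (p : ℕ) : ℝ := √2⁻¹ ^ ((p : ℝ)⁻¹)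

lemma sqrt_two_inv_lt_one : √(2⁻¹ : ℝ) < 1 := by
  rw [Real.sqrt_lt' one_pos]; norm_num

lemma kolmogorovRatio_pos (p : ℕ) : 0 < kolmogorovRatio p :=
  Real.rpow_pos_of_pos (by positivity) _

lemma kolmogorovRatio_lt_one {p : ℕ} (hp : p ≠ 0) : kolmogorovRatio p < 1 :=
  Real.rpow_lt_one (by positivity) sqrt_two_inv_lt_one (by positivity)

lemma kolmogorovRatio_pow {p : ℕ} (hp : p ≠ 0) : kolmogorovRatio p ^ p = √2⁻¹ :=
  Real.rpow_inv_natCast_pow (by positivity) hp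

variable {Ω : Type*} [MeasurableSpace Ω] {P : Measure Ω}

/-- A moment bound of order `p` for the increments of a process on the interval `[-M, M]`. -/
def IncrementMomentLE (P : Measure Ω) (Y : ℝ → Ω → ℝ) (M p : ℕ) (K : ENNReal) : Prop :=
  ∀ s ∈ Set.Icc (-(M : ℝ)) M, ∀ t ∈ Set.Icc (-(M : ℝ)) M, |s - t| ≤ 1 →
    ∫⁻ ω, ‖Y s ω - Y t ω‖ₑ ^ p ∂P ≤ K * ENNReal.ofReal (|s - t| ^ 2)

lemma dyadic_mem_Icc {M n : ℕ} {k : ℤ} (hk : k ∈ Finset.Ico (-(M * 2 ^ n : ℤ)) (M * 2 ^ n)) :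
    ((k : ℝ) + 1) / 2 ^ n ∈ Set.Icc (-(M : ℝ)) M ∧ (k : ℝ) / 2 ^ n ∈ Set.Icc (-(M : ℝ)) M := by
  rw [Finset.mem_Ico] at hk
  have h1 : (-(M * 2 ^ n) : ℝ) ≤ k := by exact_mod_cast hk.1
  have h2 : (k : ℝ) + 1 ≤ M * 2 ^ n := by exact_mod_cast hk.2
  have hpos : (0 : ℝ) < 2 ^ n := by positivity
  simp only [Set.mem_Icc, le_div_iff₀ hpos, div_le_iff₀ hpos]
  refine ⟨⟨?_, ?_⟩, ?_, ?_⟩ <;> linarith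

/-- Markov's inequality: the moment is at most `K 4 ^ (-n)`, and the threshold has `p`-th power `A ^
p 2 ^ (-n/2)`. The quotient contains `2 ^ (-n)`, which pays for the number of dyadic cells, and a
further `2 ^ (-n/2)`, which is summable. -/
lemma IncrementMomentLE.measure_dyadic_lt {Y : ℝ → Ω → ℝ} (hY : ∀ t, AEMeasurable (Y t) P)
    {M p : ℕ} (hp : p ≠ 0) {K : ENNReal} (h : IncrementMomentLE P Y M p K) {A : ℝ} (hA : 0 < A)
    (n : ℕ) {k : ℤ} (hk : k ∈ Finset.Ico (-(M * 2 ^ n : ℤ)) (M * 2 ^ n)) :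
    P {ω | A * kolmogorovRatio p ^ n < |Y ((k + 1) / 2 ^ n) ω - Y (k / 2 ^ n) ω|} ≤
      K / ENNReal.ofReal (A ^ p) * ENNReal.ofReal (√2⁻¹ ^ n / 2 ^ n) := by
  have hb := kolmogorovRatio_pos p
  obtain ⟨m1, m2⟩ := dyadic_mem_Icc hk
  have hd : |((k : ℝ) + 1) / 2 ^ n - k / 2 ^ n| = (2 ^ n)⁻¹ := by
    rw [← sub_div, add_sub_cancel_left, one_div, abs_of_pos (by positivity)]
  have h1 := h _ m1 _ m2 (by rw [hd]; exact inv_le_one_of_one_le₀ (one_le_pow₀ (by norm_num)))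
  rw [hd] at h1
  have hε : 0 < (A * kolmogorovRatio p ^ n) ^ p := by positivity
  have hme : AEMeasurable (fun ω => ‖Y ((k + 1) / 2 ^ n) ω - Y (k / 2 ^ n) ω‖ₑ ^ p) P :=
    (((hY _).sub (hY _)).enorm).pow_const p
  have h2 : P {ω | A * kolmogorovRatio p ^ n < |Y ((k + 1) / 2 ^ n) ω - Y (k / 2 ^ n) ω|} ≤
      P {ω | ENNReal.ofReal ((A * kolmogorovRatio p ^ n) ^ p) ≤
        ‖Y ((k + 1) / 2 ^ n) ω - Y (k / 2 ^ n) ω‖ₑ ^ p} := by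
    refine measure_mono fun ω hω => ?_
    simp only [Set.mem_ofPred_eq] at hω ⊢
    rw [ENNReal.ofReal_pow (by positivity), Real.enorm_eq_ofReal_abs]
    gcongr
  refine h2.trans ((meas_ge_le_lintegral_div hme (ENNReal.ofReal_pos.2 hε).ne'
    ENNReal.ofReal_ne_top).trans ((ENNReal.div_le_div_right h1 _).trans_eq ?_))
  have e1 : (A * kolmogorovRatio p ^ n) ^ p = A ^ p * √2⁻¹ ^ n := by
    rw [mul_pow, pow_right_comm, kolmogorovRatio_pow hp]
  rw [e1, ENNReal.ofReal_mul (by positivity), div_eq_mul_inv, div_eq_mul_inv,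
    ENNReal.mul_inv (Or.inr ENNReal.ofReal_ne_top) (Or.inl ENNReal.ofReal_ne_top),
    mul_mul_mul_comm, ← div_eq_mul_inv (ENNReal.ofReal _), ← ENNReal.ofReal_div_of_pos (by positivity)]
  congr 2
  have e2 : √(2⁻¹ : ℝ) ^ n * √(2⁻¹ : ℝ) ^ n = (2 ^ n)⁻¹ := by
    rw [← mul_pow, Real.mul_self_sqrt (by norm_num), inv_pow]
  have e3 : (√(2⁻¹ : ℝ) ^ n) ≠ 0 := by positivity
  rw [div_eq_div_iff e3 (by positivity), e2]
  field_simp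

lemma IncrementMomentLE.measure_not_dyadicIncrementsLE {Y : ℝ → Ω → ℝ}
    (hY : ∀ t, AEMeasurable (Y t) P) {M p : ℕ} (hp : p ≠ 0) {K : ENNReal}
    (h : IncrementMomentLE P Y M p K) {A : ℝ} (hA : 0 < A) :
    P {ω | ¬ DyadicIncrementsLE (fun t => Y t ω) M A (kolmogorovRatio p)} ≤
      K / ENNReal.ofReal (A ^ p) * ENNReal.ofReal (2 * M * (1 - √2⁻¹)⁻¹) := by
  have hsub : {ω | ¬ DyadicIncrementsLE (fun t => Y t ω) M A (kolmogorovRatio p)} ⊆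
      ⋃ n : ℕ, ⋃ k ∈ Finset.Ico (-(M * 2 ^ n : ℤ)) (M * 2 ^ n),
      {ω | A * kolmogorovRatio p ^ n < |Y ((k + 1) / 2 ^ n) ω - Y (k / 2 ^ n) ω|} := by
    intro ω hω
    simp only [DyadicIncrementsLE, Set.mem_ofPred_eq, not_forall, not_le] at hω
    obtain ⟨n, k, hk, hlt⟩ := hω
    simp only [Set.mem_iUnion]
    exact ⟨n, k, hk, hlt⟩
  have hc := sqrt_two_inv_lt_one
  have hc0 : 0 ≤ √(2⁻¹ : ℝ) := by positivity
  calc _ ≤ _ := measure_mono hsub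
    _ ≤ ∑' n : ℕ, P (⋃ k ∈ Finset.Ico (-(M * 2 ^ n : ℤ)) (M * 2 ^ n),
      {ω | A * kolmogorovRatio p ^ n < |Y ((k + 1) / 2 ^ n) ω - Y (k / 2 ^ n) ω|}) :=
        measure_iUnion_le _
    _ ≤ ∑' n : ℕ, K / ENNReal.ofReal (A ^ p) * ENNReal.ofReal (2 * M * √2⁻¹ ^ n) := by
        refine ENNReal.tsum_le_tsum fun n => ?_
        refine (measure_biUnion_finset_le _ _).trans
          ((Finset.sum_le_sum fun k hk => h.measure_dyadic_lt hY hp hA n hk).trans_eq ?_)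
        rw [Finset.sum_const, nsmul_eq_mul, mul_left_comm, Int.card_Ico]
        congr 1
        rw [← ENNReal.ofReal_natCast, ← ENNReal.ofReal_mul (by positivity)]
        congr 1
        have : (((M * 2 ^ n - -(M * 2 ^ n) : ℤ).toNat : ℕ) : ℝ) = 2 * M * 2 ^ n := by
          have h0 : (M * 2 ^ n - -(M * 2 ^ n) : ℤ) = ((2 * M * 2 ^ n : ℕ) : ℤ) := by
            push_cast; ring
          rw [h0, Int.toNat_natCast]
          push_cast
          ring
        rw [this]
        field_simp
    _ = _ := by
        rw [ENNReal.tsum_mul_left, ← ENNReal.ofReal_tsum_of_nonneg (fun n => by positivity)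
          ((summable_geometric_of_lt_one hc0 hc).mul_left _), tsum_mul_left,
          tsum_geometric_of_lt_one hc0 hc]

lemma measurableSet_dyadicIncrementsLE {Y : ℝ → Ω → ℝ} (hY : ∀ t, Measurable (Y t))
    (M : ℕ) (A b : ℝ) : MeasurableSet {ω | DyadicIncrementsLE (fun t => Y t ω) M A b} := by
  have : {ω | DyadicIncrementsLE (fun t => Y t ω) M A b} =
      ⋂ n : ℕ, ⋂ k ∈ Finset.Ico (-(M * 2 ^ n : ℤ)) (M * 2 ^ n),
      {ω | |Y ((k + 1) / 2 ^ n) ω - Y (k / 2 ^ n) ω| ≤ A * b ^ n} := by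
    ext ω
    simp only [DyadicIncrementsLE, Set.mem_ofPred_eq, Set.mem_iInter]
  rw [this]
  refine MeasurableSet.iInter fun n => Finset.measurableSet_biInter _ fun k _ => ?_
  exact measurableSet_le ((hY _).sub (hY _)).abs measurable_const

/-- The exceptional event is contained in the failure for each fixed `A`, whose probability is of
order `A ^ (-p)`. -/
lemma IncrementMomentLE.ae_exists_dyadicIncrementsLE {Y : ℝ → Ω → ℝ}
    (hY : ∀ t, AEMeasurable (Y t) P) {M p : ℕ} (hp : p ≠ 0) {K : ENNReal} (hK : K ≠ ⊤)
    (h : IncrementMomentLE P Y M p K) :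
    ∀ᵐ ω ∂P, ∃ A : ℕ, DyadicIncrementsLE (fun t => Y t ω) M A (kolmogorovRatio p) := by
  rw [ae_iff]
  have h1 : ∀ A : ℕ, P {ω | ¬ ∃ A : ℕ, DyadicIncrementsLE (fun t => Y t ω) M A (kolmogorovRatio p)}
      ≤ K / ENNReal.ofReal ((A + 1 : ℕ) ^ p) * ENNReal.ofReal (2 * M * (1 - √2⁻¹)⁻¹) := by
    intro A
    refine (measure_mono fun ω hω => ?_).trans (h.measure_not_dyadicIncrementsLE hY hp
      (A := (A + 1 : ℕ)) (by positivity))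
    exact not_exists.1 hω _
  have h2 : Tendsto (fun A : ℕ => K / ENNReal.ofReal ((A + 1 : ℕ) ^ p) *
      ENNReal.ofReal (2 * M * (1 - √2⁻¹)⁻¹)) atTop (𝓝 (K / ⊤ * ENNReal.ofReal
        (2 * M * (1 - √2⁻¹)⁻¹))) := by
    refine ENNReal.Tendsto.mul_const (ENNReal.Tendsto.const_div ?_ (Or.inr hK))
      (Or.inr ENNReal.ofReal_ne_top)
    refine ENNReal.tendsto_ofReal_atTop.comp ((tendsto_pow_atTop hp).comp ?_)
    exact tendsto_natCast_atTop_atTop.comp (tendsto_add_atTop_nat 1)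
  rw [ENNReal.div_top, zero_mul] at h2
  exact le_antisymm (ge_of_tendsto' h2 h1) zero_le

/-- The Kolmogorov continuity criterion: a process with suitable moment bounds for its increments
has a version with continuous paths. -/
theorem exists_continuous_version {Y : ℝ → Ω → ℝ} (hY : ∀ t, AEMeasurable (Y t) P)
    (h : ∀ M : ℕ, ∃ p : ℕ, p ≠ 0 ∧ ∃ K : ENNReal, K ≠ ⊤ ∧ IncrementMomentLE P Y M p K) :
    ∃ X : Ω → C(ℝ, ℝ), Measurable X ∧ ∀ t, (fun ω => X ω t) =ᵐ[P] Y t := by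
  wlog hYm : ∀ t, Measurable (Y t) generalizing Y
  · have hm : ∀ M : ℕ, ∃ p : ℕ, p ≠ 0 ∧ ∃ K : ENNReal, K ≠ ⊤ ∧
        IncrementMomentLE P (fun t => (hY t).mk (Y t)) M p K := by
      intro M
      obtain ⟨p, hp, K, hK, hM⟩ := h M
      refine ⟨p, hp, K, hK, fun s hs t ht hst => (lintegral_congr_ae ?_).trans_le (hM s hs t ht hst)⟩
      filter_upwards [(hY s).ae_eq_mk, (hY t).ae_eq_mk] with ω h1 h2
      rw [h1, h2]
    obtain ⟨X, hX, hX'⟩ := this (fun t => (hY t).measurable_mk.aemeasurable) hm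
      fun t => (hY t).measurable_mk
    exact ⟨X, hX, fun t => (hX' t).trans (hY t).ae_eq_mk.symm⟩
  choose p hp K hK hM using h
  let G : Set Ω := {ω | ∀ M : ℕ, ∃ A : ℕ,
    DyadicIncrementsLE (fun t => Y t ω) M A (kolmogorovRatio (p M))}
  have hG : MeasurableSet G := by
    have : G = ⋂ M : ℕ, ⋃ A : ℕ,
        {ω | DyadicIncrementsLE (fun t => Y t ω) M A (kolmogorovRatio (p M))} := by
      ext ω; simp [G]
    rw [this]
    exact MeasurableSet.iInter fun M => MeasurableSet.iUnion fun A =>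
      measurableSet_dyadicIncrementsLE hYm M A _
  have hGae : ∀ᵐ ω ∂P, ω ∈ G :=
    ae_all_iff.2 fun M => (hM M).ae_exists_dyadicIncrementsLE hY (hp M) (hK M)
  -- On the null set off `G` the path is replaced by `0`, so that every path is continuous and
  -- measurability is kept.
  have h1 : ∀ ω, ∃ g : C(ℝ, ℝ), ∀ t,
      Tendsto (fun n => G.indicator (Y (dyadicFloor n t)) ω) atTop (𝓝 (g t)) := by
    intro ω
    by_cases hω : ω ∈ G
    · simp only [Set.indicator_of_mem hω]
      exact exists_continuousMap_of_dyadicIncrementsLE (fun M => (kolmogorovRatio_pos _).le)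
        (fun M => kolmogorovRatio_lt_one (hp M)) hω
    · exact ⟨0, fun t => by simp [Set.indicator_of_notMem hω]⟩
  choose X hX using h1
  have hXm (t : ℝ) : Measurable fun ω => X ω t :=
    measurable_of_tendsto_metrizable (fun n => (hYm _).indicator hG)
      (tendsto_pi_nhds.2 fun ω => hX ω t)
  refine ⟨X, measurable_of_measurable_eval hXm, fun t => ?_⟩
  -- The margin `1` keeps all dyadic floors of `t` in `[-M, M]`.
  obtain ⟨M, hMt⟩ := exists_nat_gt (|t| + 1)
  have h2 : ∀ n, dyadicFloor n t ∈ Set.Icc (-(M : ℝ)) M ∧ |dyadicFloor n t - t| ≤ (2 ^ n)⁻¹ ∧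
      ((2 : ℝ) ^ n)⁻¹ ≤ 1 := by
    intro n
    have h3 := dyadicFloor_le n t
    have h4 := lt_dyadicFloor_add n t
    have h5 : ((2 : ℝ) ^ n)⁻¹ ≤ 1 := inv_le_one_of_one_le₀ (one_le_pow₀ (by norm_num))
    refine ⟨⟨?_, ?_⟩, ?_, h5⟩
    · linarith [neg_abs_le t]
    · linarith [le_abs_self t]
    · rw [abs_le]; constructor <;> linarith
  have ht : t ∈ Set.Icc (-(M : ℝ)) M := ⟨by linarith [neg_abs_le t], by linarith [le_abs_self t]⟩
  -- Fatou's lemma along the dyadic floors of `t` identifies the limit with `Y t`.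
  have h3 : ∫⁻ ω, ‖X ω t - Y t ω‖ₑ ^ p M ∂P ≤ 0 := by
    calc ∫⁻ ω, ‖X ω t - Y t ω‖ₑ ^ p M ∂P
        = ∫⁻ ω, liminf (fun n => ‖Y (dyadicFloor n t) ω - Y t ω‖ₑ ^ p M) atTop ∂P := by
          refine lintegral_congr_ae ?_
          filter_upwards [hGae] with ω hω
          have := hX ω t
          simp only [Set.indicator_of_mem hω] at this
          exact (((ENNReal.continuous_pow (p M)).tendsto _).comp
            (this.sub_const (Y t ω)).enorm).liminf_eq.symm
      _ ≤ liminf (fun n => ∫⁻ ω, ‖Y (dyadicFloor n t) ω - Y t ω‖ₑ ^ p M ∂P) atTop :=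
          lintegral_liminf_le fun n => ((hYm _).sub (hYm _)).enorm.pow_const _
      _ ≤ liminf (fun n : ℕ => K M * ENNReal.ofReal (((2 ^ n)⁻¹) ^ 2)) atTop := by
          refine liminf_le_liminf (Eventually.of_forall fun n => ?_)
          obtain ⟨h4, h5, h6⟩ := h2 n
          refine (hM M _ h4 t ht (h5.trans h6)).trans ?_
          gcongr
      _ = 0 := by
          have h4 : Tendsto (fun n : ℕ => K M * ENNReal.ofReal (((2 ^ n)⁻¹) ^ 2)) atTop
              (𝓝 (K M * ENNReal.ofReal (0 ^ 2))) := by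
            refine ENNReal.Tendsto.const_mul (ENNReal.tendsto_ofReal (Tendsto.pow ?_ 2))
              (Or.inr (hK M))
            simp only [← inv_pow]
            exact tendsto_pow_atTop_nhds_zero_of_lt_one (by norm_num) (by norm_num)
          rw [h4.liminf_eq]
          simp
  have h4 := (lintegral_eq_zero_iff (((hXm t).sub (hYm t)).enorm.pow_const _)).1 (le_antisymm h3 zero_le)
  filter_upwards [h4] with ω hω
  simpa [hp M, sub_eq_zero] using hω

/-- A maximal inequality for processes with continuous paths which start at `0`. -/
theorem exists_measure_abs_gt_le (M p : ℕ) (hp : p ≠ 0) {δ : ℝ} (hδ : 0 < δ) :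
    ∃ C : ENNReal, C ≠ ⊤ ∧ ∀ {V : Ω → C(ℝ, ℝ)} {K : ENNReal}, Measurable V → (∀ ω, V ω 0 = 0) →
      IncrementMomentLE P (fun t ω => V ω t) M p K →
      P {ω | ∃ t ∈ Set.Ico (-(M : ℝ)) M, δ < |V ω t|} ≤ K * C := by
  have hb := kolmogorovRatio_pos p
  have hb1 := sub_pos.2 (kolmogorovRatio_lt_one hp)
  -- With increment constant `δ / S`, the bound from `DyadicIncrementsLE.abs_le_of_continuous` is at
  -- most `δ`.
  set S := M + 1 + kolmogorovRatio p / (1 - kolmogorovRatio p) with hS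
  have hS0 : 0 < S := by positivity
  have hA : 0 < δ / S := by positivity
  refine ⟨(ENNReal.ofReal ((δ / S) ^ p))⁻¹ * ENNReal.ofReal (2 * M * (1 - √2⁻¹)⁻¹),
    ENNReal.mul_ne_top (ENNReal.inv_ne_top.2 (ENNReal.ofReal_pos.2 (by positivity)).ne')
      ENNReal.ofReal_ne_top, ?_⟩
  intro V K hV h0 h
  rw [← mul_assoc, ← div_eq_mul_inv]
  refine (measure_mono fun ω hω => ?_).trans (h.measure_not_dyadicIncrementsLE
    (fun t => ((measurable_eval_CReal t).comp hV).aemeasurable) hp hA)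
  obtain ⟨t, ht, hlt⟩ := hω
  intro hD
  have h1 : |V ω t| ≤ _ := hD.abs_le_of_continuous hA.le hb.le (kolmogorovRatio_lt_one hp) (V ω).continuous
    (h0 ω) ht
  have h2 : δ / S * (M + kolmogorovRatio p / (1 - kolmogorovRatio p)) ≤ δ / S * S := by
    gcongr
    rw [hS]; linarith
  rw [div_mul_cancel₀ _ hS0.ne'] at h2
  linarith

end Kolmogorov

/-! ### A Slutsky theorem in `C(ℝ)`. -/

section Slutsky

/-- Continuity of a function on `C(ℝ)` in terms of uniform closeness on bounded intervals. -/
lemma exists_forall_dist_le_of_continuous {φ : C(ℝ, ℝ) → ℝ} (hφ : Continuous φ) (x : C(ℝ, ℝ))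
    {ε : ℝ} (hε : 0 < ε) : ∃ m : ℕ, ∀ v : C(ℝ, ℝ),
      (∀ t ∈ Set.Ico (-(m : ℝ)) m, |v t| ≤ ((m : ℝ) + 1)⁻¹) → |φ (x + v) - φ x| ≤ ε := by
  -- Otherwise there are perturbations `v m`, below `1 / (m + 1)` on `[-m, m)`, which tend to `0`
  -- locally uniformly and contradict continuity at `x`.
  by_contra! hcon
  choose v hv hv' using hcon
  have h1 : Tendsto v atTop (𝓝 0) := by
    rw [ContinuousMap.tendsto_iff_forall_isCompact_tendstoUniformlyOn]
    intro K hK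
    rw [Metric.tendstoUniformlyOn_iff]
    intro δ hδ
    obtain ⟨R, hR⟩ := hK.isBounded.exists_norm_le
    obtain ⟨N, hN⟩ := exists_nat_gt R
    have h2 : Tendsto (fun m : ℕ => ((m : ℝ) + 1)⁻¹) atTop (𝓝 0) := by
      simpa using tendsto_one_div_add_atTop_nhds_zero_nat (𝕜 := ℝ)
    filter_upwards [h2.eventually_lt_const hδ, eventually_ge_atTop N] with m hm hNm t ht
    have h3 : |t| < m := (hR t ht).trans_lt (hN.trans_le (by exact_mod_cast hNm))
    rw [dist_comm, Real.dist_eq]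
    simp only [ContinuousMap.coe_zero, Pi.zero_apply, sub_zero]
    exact (hv m t ⟨(abs_lt.1 h3).1.le, (abs_lt.1 h3).2⟩).trans_lt hm
  have h2 : Tendsto (fun m => |φ (x + v m) - φ x|) atTop (𝓝 |φ (x + 0) - φ x|) :=
    (((hφ.tendsto _).comp (h1.const_add x)).sub_const _).abs
  rw [add_zero, sub_self, abs_zero] at h2
  obtain ⟨m, hm⟩ := (h2.eventually_lt_const hε).exists
  exact (hv' m).not_gt hm

lemma isOpen_exists_lt_abs (s : Set ℝ) (δ : ℝ) : IsOpen {f : C(ℝ, ℝ) | ∃ t ∈ s, δ < |f t|} := by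
  have : {f : C(ℝ, ℝ) | ∃ t ∈ s, δ < |f t|} = ⋃ t ∈ s, {f : C(ℝ, ℝ) | δ < |f t|} := by
    ext f; simp
  rw [this]
  exact isOpen_biUnion fun t _ => isOpen_lt continuous_const (continuous_eval_const t).abs

/-- A perturbation of random elements of `C(ℝ)` with a constant law by random elements which tend
to `0` in probability, uniformly on bounded intervals, converges in distribution. -/
theorem tendstoInDistribution_add_of_map_eq {Ω ι : Type*} [MeasurableSpace Ω] {P : Measure Ω}
    [IsProbabilityMeasure P] {l : Filter ι} {X Y V : ι → Ω → C(ℝ, ℝ)} {Z : Ω → C(ℝ, ℝ)}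
    (hX : ∀ i, Measurable (X i)) (hY : ∀ i, Measurable (Y i)) (hV : ∀ i, Measurable (V i))
    (hZ : Measurable Z) (hXY : ∀ i ω, X i ω = Y i ω + V i ω)
    (hYZ : ∀ᶠ i in l, P.map (Y i) = P.map Z)
    (h0 : ∀ (M : ℕ) (δ : ℝ), 0 < δ →
      Tendsto (fun i => P {ω | ∃ t ∈ Set.Ico (-(M : ℝ)) M, δ < |V i ω t|}) l (𝓝 0)) :
    TendstoInDistribution X l Z (fun _ => P) P where
  forall_aemeasurable i := (hX i).aemeasurable
  aemeasurable_limit := hZ.aemeasurable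
  tendsto := by
    refine ProbabilityMeasure.tendsto_iff_forall_integral_tendsto.2 fun φ => ?_
    simp only [ProbabilityMeasure.coe_mk]
    rw [Metric.tendsto_nhds]
    intro ε hε
    set B := ‖φ‖ with hB
    have hB0 : 0 ≤ B := norm_nonneg _
    -- `φ` need not be uniformly continuous. These sets collect the points with a common modulus;
    -- they increase to the whole space, so one of them has nearly full mass for the single law
    -- shared by `Z` and, eventually, all `Y i`.
    let A : ℕ → Set C(ℝ, ℝ) := fun m => {x | ∀ v : C(ℝ, ℝ),
      (∀ t ∈ Set.Ico (-(m : ℝ)) m, |v t| ≤ ((m : ℝ) + 1)⁻¹) → |φ (x + v) - φ x| ≤ ε / 2}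
    have hA : ∀ m, MeasurableSet (A m) := by
      intro m
      have : A m = ⋂ v ∈ {v : C(ℝ, ℝ) | ∀ t ∈ Set.Ico (-(m : ℝ)) m, |v t| ≤ ((m : ℝ) + 1)⁻¹},
        {x | |φ (x + v) - φ x| ≤ ε / 2} := by
        ext x; simp [A]
      rw [this]
      refine (isClosed_biInter fun v _ => isClosed_le ?_ continuous_const).measurableSet
      exact ((φ.continuous.comp (continuous_add_const v)).sub φ.continuous).abs
    have hmono : Monotone A := by
      intro m n hmn x hx v hv
      have hmn' : (m : ℝ) ≤ n := by exact_mod_cast hmn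
      refine hx v fun t ht => (hv t ⟨by linarith [ht.1], by linarith [ht.2]⟩).trans ?_
      gcongr
    have hUn : ⋃ m, A m = Set.univ := Set.eq_univ_of_forall fun x => Set.mem_iUnion.2
      (exists_forall_dist_le_of_continuous φ.continuous x (by linarith))
    have hPZ := Measure.isProbabilityMeasure_map (μ := P) hZ.aemeasurable
    have h1 : Tendsto (fun m => (P.map Z).real (A m)ᶜ) atTop (𝓝 0) := by
      have := tendsto_measure_iUnion_atTop (μ := P.map Z) hmono
      rw [hUn, measure_univ] at this
      have h2 := (ENNReal.tendsto_toReal ENNReal.one_ne_top).comp this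
      have h3 : Tendsto (fun m => 1 - (P.map Z).real (A m)) atTop (𝓝 (1 - 1)) :=
        tendsto_const_nhds.sub h2
      rw [sub_self] at h3
      refine h3.congr fun m => ?_
      rw [probReal_compl_eq_one_sub (hA m)]
    -- Each of the two exceptional events costs `2B` times its probability, at most `ε / 4`; the
    -- added `1` admits `B = 0`.
    have hη : 0 < ε / (8 * (B + 1)) := by positivity
    obtain ⟨m, hm⟩ := (h1.eventually_lt_const hη).exists
    have h2 := (ENNReal.tendsto_toReal ENNReal.zero_ne_top).comp
      (h0 m ((m : ℝ) + 1)⁻¹ (by positivity))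
    filter_upwards [hYZ, h2.eventually_lt_const hη] with i hi hVi
    let bad : Set C(ℝ, ℝ) := {f | ∃ t ∈ Set.Ico (-(m : ℝ)) m, ((m : ℝ) + 1)⁻¹ < |f t|}
    have hbad : MeasurableSet bad := (isOpen_exists_lt_abs _ _).measurableSet
    have hm1 : MeasurableSet (Y i ⁻¹' (A m)ᶜ) := hY i (hA m).compl
    have hm2 : MeasurableSet (V i ⁻¹' bad) := hV i hbad
    have e1 : P.real (Y i ⁻¹' (A m)ᶜ) = (P.map Z).real (A m)ᶜ := by
      rw [← hi, map_measureReal_apply (hY i) (hA m).compl]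
    have hle : ∀ ω, |φ (X i ω) - φ (Y i ω)| ≤ ε / 2 +
        ((Y i ⁻¹' (A m)ᶜ).indicator (fun _ => 2 * B) ω + (V i ⁻¹' bad).indicator (fun _ => 2 * B) ω) := by
      intro ω
      have hb1 : |φ (X i ω) - φ (Y i ω)| ≤ 2 * B := by
        have := φ.dist_le_two_norm (X i ω) (Y i ω)
        rwa [Real.dist_eq] at this
      have hi1 : 0 ≤ (Y i ⁻¹' (A m)ᶜ).indicator (fun _ => 2 * B) ω :=
        Set.indicator_nonneg (fun _ _ => by positivity) _
      have hi2 : 0 ≤ (V i ⁻¹' bad).indicator (fun _ => 2 * B) ω :=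
        Set.indicator_nonneg (fun _ _ => by positivity) _
      by_cases hy : ω ∈ Y i ⁻¹' (A m)ᶜ
      · rw [Set.indicator_of_mem hy]
        linarith
      by_cases hv : ω ∈ V i ⁻¹' bad
      · rw [Set.indicator_of_mem hv]
        linarith
      · have hy' : Y i ω ∈ A m := not_not.1 hy
        have := hy' (V i ω) fun t ht => not_lt.1 fun hlt => hv ⟨t, ht, hlt⟩
        rw [← hXY] at this
        linarith
    have hiX : Integrable (fun ω => φ (X i ω)) P :=
      Integrable.of_bound (φ.continuous.measurable.comp (hX i)).aestronglyMeasurable B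
        (Eventually.of_forall fun ω => φ.norm_coe_le_norm _)
    have hiY : Integrable (fun ω => φ (Y i ω)) P :=
      Integrable.of_bound (φ.continuous.measurable.comp (hY i)).aestronglyMeasurable B
        (Eventually.of_forall fun ω => φ.norm_coe_le_norm _)
    have hii1 : Integrable ((Y i ⁻¹' (A m)ᶜ).indicator (fun _ : Ω => 2 * B)) P :=
      (integrable_const _).indicator hm1
    have hii2 : Integrable ((V i ⁻¹' bad).indicator (fun _ : Ω => 2 * B)) P :=
      (integrable_const _).indicator hm2
    have hii : Integrable (fun ω => (Y i ⁻¹' (A m)ᶜ).indicator (fun _ => 2 * B) ω +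
        (V i ⁻¹' bad).indicator (fun _ => 2 * B) ω) P := hii1.add hii2
    rw [← hi, integral_map (hX i).aemeasurable φ.continuous.aestronglyMeasurable,
      integral_map (hY i).aemeasurable φ.continuous.aestronglyMeasurable, Real.dist_eq,
      ← integral_sub hiX hiY]
    have hVr : P.real (V i ⁻¹' bad) < ε / (8 * (B + 1)) := hVi
    have hBε : 2 * B * (ε / (8 * (B + 1))) ≤ ε / 4 := by
      rw [← mul_div_assoc, div_le_div_iff₀ (by positivity) (by norm_num)]
      nlinarith
    calc |∫ ω, φ (X i ω) - φ (Y i ω) ∂P| ≤ ∫ ω, |φ (X i ω) - φ (Y i ω)| ∂P :=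
          abs_integral_le_integral_abs
      _ ≤ ∫ ω, (ε / 2 + ((Y i ⁻¹' (A m)ᶜ).indicator (fun _ => 2 * B) ω +
          (V i ⁻¹' bad).indicator (fun _ => 2 * B) ω)) ∂P :=
          integral_mono (hiX.sub hiY).abs ((integrable_const _).add hii) hle
      _ = ε / 2 + (P.real (Y i ⁻¹' (A m)ᶜ) * (2 * B) + P.real (V i ⁻¹' bad) * (2 * B)) := by
          rw [integral_add (integrable_const _) hii, integral_add hii1 hii2,
            integral_indicator_const _ hm1, integral_indicator_const _ hm2]
          simp
      _ < ε := by
          rw [e1]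
          rcases hB0.eq_or_lt with h | h
          · rw [← h]; linarith
          · have := mul_lt_mul_of_pos_right hm (show 0 < 2 * B by positivity)
            have := mul_lt_mul_of_pos_right hVr (show 0 < 2 * B by positivity)
            linarith

end Slutsky

/-! ### Gaussian processes: moments, continuous versions, laws. -/

section GaussianPaths

variable {Ω : Type*} [MeasurableSpace Ω] {P : Measure Ω} {W : Set ℝ → Ω → ℝ}

lemma aemeasurable_Lp (x : Lp ℝ 2 P) : AEMeasurable x P := (Lp.aestronglyMeasurable x).aemeasurable

/-- The absolute moment of order `p` of the standard normal distribution. -/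
def gaussianMoment (p : ℕ) : ENNReal := ∫⁻ y, ‖y‖ₑ ^ p ∂gaussianReal 0 1

lemma gaussianMoment_ne_top (p : ℕ) : gaussianMoment p ≠ ⊤ := by
  rcases eq_or_ne p 0 with rfl | hp
  · simp [gaussianMoment]
  have h := (memLp_id_gaussianReal (μ := 0) (v := 1) (p : ℝ≥0)).2
  rw [eLpNorm_lt_top_iff_lintegral_rpow_enorm_lt_top (by simpa using hp) (by simp)] at h
  simpa [gaussianMoment] using h.ne

/-- A centred normal variable is its standard deviation times a standard one, so the `L²` norm
controls every moment. -/
lemma IsWienerMeasure.lintegral_enorm_pow_isometry (hW : IsWienerMeasure P W)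
    (x : Lp ℝ 2 (volume : Measure ℝ)) (p : ℕ) :
    ∫⁻ ω, ‖hW.isometry x ω‖ₑ ^ p ∂P = gaussianMoment p * ENNReal.ofReal (‖x‖ ^ p) := by
  have hm : Measurable fun y : ℝ => ‖y‖ₑ ^ p := by fun_prop
  rw [← lintegral_map' (f := fun y : ℝ => ‖y‖ₑ ^ p) hm.aemeasurable (aemeasurable_Lp _),
    hW.map_isometry]
  have h1 : gaussianReal 0 (‖x‖₊ ^ 2) = (gaussianReal 0 1).map (‖x‖ * ·) := by
    rw [gaussianReal_map_const_mul]
    congr 1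
    · simp
    · ext; simp
  rw [h1, lintegral_map hm (by fun_prop)]
  simp only [enorm_mul, mul_pow]
  rw [lintegral_const_mul _ hm, mul_comm, gaussianMoment, enorm_norm, ENNReal.ofReal_pow (norm_nonneg _),
    ofReal_norm]

/-- Moment bounds for the increments of a Gaussian process from bounds on their variances. -/
lemma IsWienerMeasure.incrementMomentLE (hW : IsWienerMeasure P W)
    {x : ℝ → Lp ℝ 2 (volume : Measure ℝ)} {Y : ℝ → Ω → ℝ} (hY : ∀ t, Y t =ᵐ[P] hW.isometry (x t))
    {M p : ℕ} {κ γ : ℝ} (hκ : 0 ≤ κ) (hp : 2 ≤ γ * p)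
    (hx : ∀ s ∈ Set.Icc (-(M : ℝ)) M, ∀ t ∈ Set.Icc (-(M : ℝ)) M, |s - t| ≤ 1 →
      ‖x s - x t‖ ≤ κ * |s - t| ^ γ) :
    IncrementMomentLE P Y M p (gaussianMoment p * ENNReal.ofReal (κ ^ p)) := by
  intro s hs t ht hst
  have h1 : ∫⁻ ω, ‖Y s ω - Y t ω‖ₑ ^ p ∂P = ∫⁻ ω, ‖hW.isometry (x s - x t) ω‖ₑ ^ p ∂P := by
    refine lintegral_congr_ae ?_
    rw [map_sub]
    filter_upwards [hY s, hY t, Lp.coeFn_sub (hW.isometry (x s)) (hW.isometry (x t))]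
      with ω h1 h2 h3
    rw [h1, h2, h3, Pi.sub_apply]
  rw [h1, hW.lintegral_enorm_pow_isometry, mul_assoc, ← ENNReal.ofReal_mul (by positivity)]
  gcongr
  calc ‖x s - x t‖ ^ p ≤ (κ * |s - t| ^ γ) ^ p := by gcongr; exact hx s hs t ht hst
    _ = κ ^ p * |s - t| ^ (γ * p) := by
      rw [mul_pow, ← Real.rpow_natCast (|s - t| ^ γ), ← Real.rpow_mul (abs_nonneg _)]
    _ ≤ κ ^ p * |s - t| ^ 2 := by
      gcongr
      rcases (abs_nonneg (s - t)).eq_or_lt with h0 | h0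
      · rw [← h0, Real.zero_rpow (by linarith)]; positivity
      · rw [← Real.rpow_two]
        exact Real.rpow_le_rpow_of_exponent_ge h0 hst hp

/-- A Gaussian process whose standard deviation is locally Hölder has a continuous version. -/
theorem IsWienerMeasure.exists_continuous_version (hW : IsWienerMeasure P W)
    {x : ℝ → Lp ℝ 2 (volume : Measure ℝ)}
    (hx : ∀ M : ℕ, ∃ κ γ : ℝ, 0 ≤ κ ∧ 0 < γ ∧ ∀ s ∈ Set.Icc (-(M : ℝ)) M,
      ∀ t ∈ Set.Icc (-(M : ℝ)) M, |s - t| ≤ 1 → ‖x s - x t‖ ≤ κ * |s - t| ^ γ) :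
    ∃ X : Ω → C(ℝ, ℝ), Measurable X ∧ ∀ t, (fun ω => X ω t) =ᵐ[P] hW.isometry (x t) := by
  refine _root_.exists_continuous_version (fun t => aemeasurable_Lp _) fun M => ?_
  obtain ⟨κ, γ, hκ, hγ, h⟩ := hx M
  -- However small `γ` is, a moment of high enough order has the exponent `γ p ≥ 2` that the
  -- criterion needs.
  obtain ⟨p, hp⟩ := exists_nat_ge (2 / γ)
  rw [div_le_iff₀' hγ] at hp
  refine ⟨p, ?_, _, ENNReal.mul_ne_top (gaussianMoment_ne_top p) ENNReal.ofReal_ne_top,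
    hW.incrementMomentLE (fun t => EventuallyEq.rfl) hκ hp h⟩
  rintro rfl
  norm_num at hp

/-- The law on `C(ℝ)` of a continuous centred Gaussian process is determined by its covariance. -/
theorem IsWienerMeasure.map_eq_of_inner_eq (hW : IsWienerMeasure P W)
    {x y : ℝ → Lp ℝ 2 (volume : Measure ℝ)}
    (h : ∀ s t, inner ℝ (x s) (x t) = inner ℝ (y s) (y t)) {X Y : Ω → C(ℝ, ℝ)}
    (hX : Measurable X) (hY : Measurable Y) (hXx : ∀ t, (fun ω => X ω t) =ᵐ[P] hW.isometry (x t))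
    (hYy : ∀ t, (fun ω => Y ω t) =ᵐ[P] hW.isometry (y t)) : P.map X = P.map Y := by
  have := hW.isGaussianProcess.isProbabilityMeasure
  refine map_eq_of_forall_finset hX hY fun I => ?_
  have hmeas {X : Ω → C(ℝ, ℝ)} (hX : Measurable X) :
      Measurable fun ω => I.restrict fun t => X ω t :=
    measurable_pi_lambda _ fun t => (measurable_eval_CReal t).comp hX
  have := Measure.isProbabilityMeasure_map (μ := P) (hmeas hX).aemeasurable
  have := Measure.isProbabilityMeasure_map (μ := P) (hmeas hY).aemeasurable
  -- Cramér–Wold: a linear functional of the coordinates is centred Gaussian, with a variance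
  -- determined by the Gram matrix.
  apply Measure.ext_of_charFunDual
  ext L
  classical
  have key {X : Ω → C(ℝ, ℝ)} {x : ℝ → Lp ℝ 2 (volume : Measure ℝ)} (hX : Measurable X)
      (hXx : ∀ t, (fun ω => X ω t) =ᵐ[P] hW.isometry (x t)) :
      (P.map (fun ω => I.restrict fun t => X ω t)).map L =
        gaussianReal 0 (‖∑ i : I, L (Pi.single i 1) • x i‖₊ ^ 2) := by
    rw [Measure.map_map (by fun_prop) (hmeas hX), ← hW.map_isometry]
    refine Measure.map_congr ?_
    have h1 : ∀ᵐ ω ∂P, ∀ i : I, X ω i = hW.isometry (x i) ω := ae_all_iff.2 fun i => hXx i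
    rw [map_sum]
    have h2 : ∀ᵐ ω ∂P, ∀ i : I, hW.isometry (L (Pi.single i 1) • x i) ω =
        L (Pi.single i 1) * hW.isometry (x i) ω := by
      refine ae_all_iff.2 fun i => ?_
      rw [map_smul]
      exact Lp.coeFn_smul _ _
    filter_upwards [h1, h2, Lp.coeFn_fun_finsetSum Finset.univ
      fun i : I => hW.isometry (L (Pi.single i 1) • x i)] with ω h1 h2 h3
    rw [h3, Function.comp_apply, ← ContinuousLinearMap.coe_coe L,
      LinearMap.pi_apply_eq_sum_univ]
    refine Finset.sum_congr rfl fun i _ => ?_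
    rw [ContinuousLinearMap.coe_coe, h2, ← h1, smul_eq_mul, mul_comm, Finset.restrict_def]
    congr 2
    ext j
    simp [Pi.single_apply, eq_comm]
  rw [charFunDual_eq_charFun_map_one, charFunDual_eq_charFun_map_one, key hX hXx, key hY hYy]
  have h3 := norm_sum_smul_eq_of_inner_eq (v := fun i : I => x i) (w := fun i : I => y i)
    (fun i j => h i j) Finset.univ (fun i => L (Pi.single i 1))
  congr 3
  exact NNReal.eq h3

end GaussianPaths

/-! ### Retraction onto a closed interval. -/

section Retraction

/-- A closed interval is a `1`-Lipschitz retract of the line. -/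
lemma exists_lipschitz_retraction {U : Set ℝ} (hUc : IsClosed U) (hUi : U.OrdConnected)
    (hne : U.Nonempty) : ∃ π : ℝ → ℝ, (∀ t, π t ∈ U) ∧ (∀ t ∈ U, π t = t) ∧
      ∀ s t, |π s - π t| ≤ |s - t| := by
  have hconv : Convex ℝ U := hUi.convex
  -- The variational inequality of the nearest point; adding it for two points gives the Lipschitz
  -- bound.
  have h1 : ∀ t : ℝ, ∃ p ∈ U, ∀ w ∈ U, (t - p) * (w - p) ≤ 0 := by
    intro t
    obtain ⟨p, hp, hmin⟩ := exists_norm_eq_iInf_of_complete_convex hne hUc.isComplete hconv t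
    refine ⟨p, hp, fun w hw => ?_⟩
    have := (norm_eq_iInf_iff_real_inner_le_zero hconv hp).1 hmin w hw
    simpa [mul_comm] using this
  choose π hπ hπ' using h1
  refine ⟨π, hπ, fun t ht => ?_, fun s t => ?_⟩
  · have := hπ' t t ht
    nlinarith [sq_nonneg (t - π t)]
  · have h2 := hπ' s (π t) (hπ t)
    have h3 := hπ' t (π s) (hπ s)
    have h4 : |π s - π t| * |π s - π t| ≤ |s - t| * |π s - π t| := by
      rw [← abs_mul, ← abs_mul, abs_of_nonneg (mul_self_nonneg _)]
      refine le_trans ?_ (le_abs_self _)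
      nlinarith
    rcases (abs_nonneg (π s - π t)).eq_or_lt with h0 | h0
    · rw [← h0]; positivity
    · exact le_of_mul_le_mul_right h4 h0

end Retraction

/-! ### `L²` estimates for multifractional Brownian motion. -/

section Multifractional

/-- The integrand `x ↦ a(t) ((t - x)₊ ^ (h(t) - 1/2) - (-x)₊ ^ (h(t) - 1/2))` of multifractional
Brownian motion as an element of `L²(ℝ)`. -/
def mbmL2 (h a : ℝ → ℝ) (t : ℝ) : Lp ℝ 2 (volume : Measure ℝ) := a t • kernelL2 (h t) t

variable {h a : ℝ → ℝ} {k l η : ℝ}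

lemma continuous_of_holder {f : ℝ → ℝ} (hη : 0 < η) (hf : ∀ s t, |f s - f t| ≤ k * |s - t| ^ η) :
    Continuous f := by
  refine continuous_iff_continuousAt.2 fun t => ?_
  rw [ContinuousAt, tendsto_iff_dist_tendsto_zero]
  have h1 : Tendsto (fun s => k * |s - t| ^ η) (𝓝 t) (𝓝 (k * |t - t| ^ η)) := by
    refine Tendsto.const_mul k ?_
    exact (((continuous_id.sub continuous_const).abs.rpow_const
      fun _ => Or.inr hη.le).tendsto t)
  rw [sub_self, abs_zero, Real.zero_rpow hη.ne', mul_zero] at h1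
  exact squeeze_zero (fun _ => dist_nonneg) (fun s => hf s t) h1

/-- On compact intervals the index is bounded away from `0` and `1`. -/
lemma exists_index_bounds (hη : 0 < η) (hh : ∀ t, h t ∈ Set.Ioo (0 : ℝ) 1)
    (hk : ∀ s t, |h s - h t| ≤ k * |s - t| ^ η) (T : ℝ) (hT : 0 ≤ T) :
    ∃ α β : ℝ, 0 < α ∧ α ≤ β ∧ β < 1 ∧ ∀ t ∈ Set.Icc (-T) T, h t ∈ Set.Icc α β := by
  have hc := (continuous_of_holder hη hk).continuousOn (s := Set.Icc (-T) T)
  have hne : (Set.Icc (-T) T).Nonempty := ⟨0, by simpa using hT⟩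
  obtain ⟨s, hs, hs'⟩ := isCompact_Icc.exists_isMinOn hne hc
  obtain ⟨t, ht, ht'⟩ := isCompact_Icc.exists_isMaxOn hne hc
  exact ⟨h s, h t, (hh s).1, hs' ht, (hh t).2, fun r hr => ⟨hs' hr, ht' hr⟩⟩

lemma exists_abs_le (hη : 0 < η) (hl : ∀ s t, |a s - a t| ≤ l * |s - t| ^ η) (T : ℝ) :
    ∃ A : ℝ, 0 ≤ A ∧ ∀ t ∈ Set.Icc (-T) T, |a t| ≤ A := by
  obtain ⟨A, hA⟩ := isCompact_Icc.exists_bound_of_continuousOn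
    ((continuous_of_holder hη hl).continuousOn (s := Set.Icc (-T) T))
  exact ⟨|A|, abs_nonneg _, fun t ht => (hA t ht).trans (le_abs_self A)⟩

lemma fbmConst_le {α β : ℝ} (hα : 0 < α) (hαβ : α ≤ β) (hβ : β < 1) :
    ∃ C : ℝ, 0 ≤ C ∧ ∀ h ∈ Set.Icc α β, fbmConst h ≤ C := by
  obtain ⟨C, hC0, hC⟩ := exists_norm_kernelL2_le hα hαβ hβ zero_le_one
  refine ⟨C, hC0, fun h hh => ?_⟩
  rw [← norm_kernelL2_one ⟨by linarith [hh.1], by linarith [hh.2]⟩]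
  exact hC h hh 1 (by simp)

/-- The integrand of multifractional Brownian motion is locally Hölder continuous in `L²(ℝ)`. -/
lemma exists_norm_mbmL2_sub_le (hη : 0 < η) (hh : ∀ t, h t ∈ Set.Ioo (0 : ℝ) 1)
    (hk0 : 0 ≤ k) (hl0 : 0 ≤ l)
    (hk : ∀ s t, |h s - h t| ≤ k * |s - t| ^ η) (hl : ∀ s t, |a s - a t| ≤ l * |s - t| ^ η)
    (M : ℕ) : ∃ κ γ : ℝ, 0 ≤ κ ∧ 0 < γ ∧ ∀ s ∈ Set.Icc (-(M : ℝ)) M,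
      ∀ t ∈ Set.Icc (-(M : ℝ)) M, |s - t| ≤ 1 → ‖mbmL2 h a s - mbmL2 h a t‖ ≤ κ * |s - t| ^ γ := by
  have hM : (0 : ℝ) ≤ M := M.cast_nonneg
  obtain ⟨α, β, hα, hαβ, hβ, hhb⟩ := exists_index_bounds hη hh hk M hM
  obtain ⟨A, hA0, hA⟩ := exists_abs_le hη hl M
  obtain ⟨C₁, hC₁0, hC₁⟩ := exists_norm_kernelL2_le hα hαβ hβ hM
  obtain ⟨C₂, hC₂0, hC₂⟩ := exists_norm_kernelL2_sub_index_le hα hαβ hβ hM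
  obtain ⟨C₃, hC₃0, hC₃⟩ := fbmConst_le hα hαβ hβ
  refine ⟨l * C₁ + A * (C₂ * k + C₃), min α η, by positivity, lt_min hα hη,
    fun s hs t ht hst => ?_⟩
  rcases eq_or_ne s t with rfl | hne
  · rw [sub_self, norm_zero]; positivity
  have hpos : 0 < |s - t| := abs_pos.2 (sub_ne_zero.2 hne)
  set γ := min α η
  have hη' : |s - t| ^ η ≤ |s - t| ^ γ :=
    Real.rpow_le_rpow_of_exponent_ge hpos hst (min_le_right _ _)
  have hα' : |s - t| ^ h t ≤ |s - t| ^ γ :=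
    Real.rpow_le_rpow_of_exponent_ge hpos hst ((min_le_left _ _).trans (hhb t ht).1)
  -- Change the amplitude, then the index at fixed time, then the time at fixed index. The first two
  -- cost `|s - t| ^ η`, the last `|s - t| ^ h t` with `h t ≥ α`.
  have e : mbmL2 h a s - mbmL2 h a t = (a s - a t) • kernelL2 (h s) s +
      a t • ((kernelL2 (h s) s - kernelL2 (h t) s) + (kernelL2 (h t) s - kernelL2 (h t) t)) := by
    simp only [mbmL2]
    module
  have b1 : ‖kernelL2 (h s) s - kernelL2 (h t) s‖ ≤ C₂ * (k * |s - t| ^ γ) :=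
    (hC₂ _ (hhb s hs) _ (hhb t ht) s hs).trans (by
      gcongr; exact (hk s t).trans (by gcongr))
  have b2 : ‖kernelL2 (h t) s - kernelL2 (h t) t‖ ≤ |s - t| ^ γ * C₃ := by
    rw [norm_kernelL2_sub (hh t)]
    exact mul_le_mul hα' (hC₃ _ (hhb t ht)) (fbmConst_pos (hh t)).le (by positivity)
  calc _ ≤ ‖(a s - a t) • kernelL2 (h s) s‖ + ‖a t • ((kernelL2 (h s) s - kernelL2 (h t) s) +
        (kernelL2 (h t) s - kernelL2 (h t) t))‖ := by rw [e]; exact norm_add_le _ _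
    _ ≤ (l * |s - t| ^ γ) * C₁ + A * (C₂ * (k * |s - t| ^ γ) + |s - t| ^ γ * C₃) := by
        rw [norm_smul, norm_smul, Real.norm_eq_abs, Real.norm_eq_abs]
        gcongr
        · exact (hl s t).trans (by gcongr)
        · exact hC₁ _ (hhb s hs) s hs
        · exact hA t ht
        · exact (norm_add_le _ _).trans (add_le_add b1 b2)
    _ = _ := by ring

/-- Near `u`, the integrand of multifractional Brownian motion is close to that of fractional
Brownian motion of index `h u`. -/
lemma exists_norm_mbmL2_sub_fbm_le (hη : 0 < η) (hh : ∀ t, h t ∈ Set.Ioo (0 : ℝ) 1)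
    (hk0 : 0 ≤ k) (hl0 : 0 ≤ l)
    (hk : ∀ s t, |h s - h t| ≤ k * |s - t| ^ η) (hl : ∀ s t, |a s - a t| ≤ l * |s - t| ^ η)
    (M : ℕ) {u : ℝ} (hu : u ∈ Set.Icc (-(M : ℝ)) M) : ∃ C : ℝ, 0 ≤ C ∧
      ∀ t ∈ Set.Icc (-(M : ℝ)) M,
      ‖mbmL2 h a t - mbmL2 (fun _ => h u) (fun _ => a u) t‖ ≤ C * |t - u| ^ η := by
  have hM : (0 : ℝ) ≤ M := M.cast_nonneg
  obtain ⟨α, β, hα, hαβ, hβ, hhb⟩ := exists_index_bounds hη hh hk M hM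
  obtain ⟨C₁, hC₁0, hC₁⟩ := exists_norm_kernelL2_le hα hαβ hβ hM
  obtain ⟨C₂, hC₂0, hC₂⟩ := exists_norm_kernelL2_sub_index_le hα hαβ hβ hM
  refine ⟨l * C₁ + |a u| * (C₂ * k), by positivity, fun t ht => ?_⟩
  have e : mbmL2 h a t - mbmL2 (fun _ => h u) (fun _ => a u) t =
      (a t - a u) • kernelL2 (h t) t + a u • (kernelL2 (h t) t - kernelL2 (h u) t) := by
    simp only [mbmL2]
    module
  calc _ ≤ ‖(a t - a u) • kernelL2 (h t) t‖ + ‖a u • (kernelL2 (h t) t - kernelL2 (h u) t)‖ := by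
        rw [e]; exact norm_add_le _ _
    _ ≤ (l * |t - u| ^ η) * C₁ + |a u| * (C₂ * (k * |t - u| ^ η)) := by
        rw [norm_smul, norm_smul, Real.norm_eq_abs, Real.norm_eq_abs]
        gcongr
        · exact hl t u
        · exact hC₁ _ (hhb t ht) t ht
        · exact (hC₂ _ (hhb t ht) _ (hhb u hu) t ht).trans (by gcongr; exact hk t u)
    _ = _ := by ring

/-- Interpolation between a Hölder condition of small exponent and a growth bound at `u` of
exponent `η > H`: the increments of the enlargements of `d` about `u` are small. -/
lemma exists_norm_enlarge_sub_le {E : Type*} [NormedAddCommGroup E] [NormedSpace ℝ E] {d : ℝ → E}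
    {u H η : ℝ} (hH : 0 < H) (hHη : H < η) {κ γ C : ℝ} {N : ℕ} (hκ : 0 ≤ κ) (hγ : 0 < γ)
    (hC : 0 ≤ C) (hN : |u| + 1 ≤ N)
    (h1 : ∀ s ∈ Set.Icc (-(N : ℝ)) N, ∀ t ∈ Set.Icc (-(N : ℝ)) N, |s - t| ≤ 1 →
      ‖d s - d t‖ ≤ κ * |s - t| ^ γ)
    (h2 : ∀ t ∈ Set.Icc (-(N : ℝ)) N, ‖d t‖ ≤ C * |t - u| ^ η) (M : ℕ) :
    ∃ K ρ δ : ℝ, 0 ≤ K ∧ 0 < ρ ∧ 0 < δ ∧ ∀ r : ℝ, 0 < r → r ≤ 1 → r * M ≤ 1 →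
      ∀ s ∈ Set.Icc (-(M : ℝ)) M, ∀ t ∈ Set.Icc (-(M : ℝ)) M, |s - t| ≤ 1 →
      ‖(r ^ H)⁻¹ • (d (u + r * s) - d u) - (r ^ H)⁻¹ • (d (u + r * t) - d u)‖ ≤
        (K * r ^ ρ) * |s - t| ^ δ := by
  have hη : 0 < η := hH.trans hHη
  -- The Hölder bound gets weight `θ` and the growth bound `1 - θ`. A positive power of `r` must
  -- remain after division by `r ^ H`, so `θ` has to lie below `1 - H / η`; half of that is taken.
  obtain ⟨θ, hθ0, hθ1, hθ⟩ : ∃ θ : ℝ, 0 < θ ∧ θ < 1 ∧ H < η * (1 - θ) := by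
    refine ⟨(1 - H / η) / 2, ?_, ?_, ?_⟩
    · have := (div_lt_one hη).2 hHη
      linarith
    · have : 0 < H / η := by positivity
      linarith
    · have : η * (1 - (1 - H / η) / 2) = (η + H) / 2 := by field_simp; ring
      rw [this]; linarith
  refine ⟨κ ^ θ * (2 * C * (M : ℝ) ^ η) ^ (1 - θ), η * (1 - θ) - H, γ * θ, by positivity,
    by linarith, by positivity, fun r hr hr1 hrM s hs t ht hst => ?_⟩
  have hmem : ∀ v ∈ Set.Icc (-(M : ℝ)) M, u + r * v ∈ Set.Icc (-(N : ℝ)) N := by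
    intro v hv
    have h3 : |r * v| ≤ 1 := by
      rw [abs_mul, abs_of_pos hr]
      exact (mul_le_mul_of_nonneg_left (abs_le.2 hv) hr.le).trans hrM
    have h4 := abs_le.1 ((abs_add_le u (r * v)).trans (by linarith : |u| + |r * v| ≤ N))
    exact h4
  have e1 : |u + r * s - (u + r * t)| = r * |s - t| := by
    rw [add_sub_add_left_eq_sub, ← mul_sub, abs_mul, abs_of_pos hr]
  have b1 : ‖d (u + r * s) - d (u + r * t)‖ ≤ κ * |s - t| ^ γ := by
    have h3 : r * |s - t| ≤ |s - t| := mul_le_of_le_one_left (abs_nonneg _) hr1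
    refine (h1 _ (hmem s hs) _ (hmem t ht) (by rw [e1]; exact h3.trans hst)).trans ?_
    rw [e1]
    gcongr
  have b2 : ∀ v ∈ Set.Icc (-(M : ℝ)) M, ‖d (u + r * v)‖ ≤ C * ((M : ℝ) ^ η * r ^ η) := by
    intro v hv
    refine (h2 _ (hmem v hv)).trans ?_
    rw [add_sub_cancel_left, abs_mul, abs_of_pos hr, ← Real.mul_rpow (by positivity) hr.le,
      mul_comm r]
    gcongr
    exact abs_le.2 hv
  have b3 : ‖d (u + r * s) - d (u + r * t)‖ ≤ 2 * C * (M : ℝ) ^ η * r ^ η := by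
    have := norm_sub_le (d (u + r * s)) (d (u + r * t))
    linarith [b2 s hs, b2 t ht]
  have b4 : ‖d (u + r * s) - d (u + r * t)‖ ≤
      (κ * |s - t| ^ γ) ^ θ * (2 * C * (M : ℝ) ^ η * r ^ η) ^ (1 - θ) := by
    set n := ‖d (u + r * s) - d (u + r * t)‖ with hn
    have hn0 : 0 ≤ n := norm_nonneg _
    calc n = n ^ θ * n ^ (1 - θ) := by
          rw [← Real.rpow_add' hn0 (by simp), add_sub_cancel, Real.rpow_one]
      _ ≤ _ := by
          have := sub_pos.2 hθ1
          gcongr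
  rw [← smul_sub, sub_sub_sub_cancel_right, norm_smul, norm_inv,
    Real.norm_of_nonneg (Real.rpow_nonneg hr.le _)]
  calc _ ≤ (r ^ H)⁻¹ * ((κ * |s - t| ^ γ) ^ θ * (2 * C * (M : ℝ) ^ η * r ^ η) ^ (1 - θ)) := by
        gcongr
    _ = _ := by
        rw [Real.mul_rpow hκ (by positivity), Real.mul_rpow (x := 2 * C * (M : ℝ) ^ η)
          (by positivity) (by positivity), ← Real.rpow_mul (abs_nonneg _), ← Real.rpow_mul hr.le,
          Real.rpow_sub hr]
        field_simp

end Multifractional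

/-! ### Localisation on the whole line. -/

section Localisation

lemma measurable_enlarge (u H r : ℝ) : Measurable (enlarge u H r) :=
  measurable_of_measurable_eval fun t =>
    ((measurable_eval_CReal (u + r * t)).sub (measurable_eval_CReal u)).div_const _

variable {Ω : Type*} [MeasurableSpace Ω] {P : Measure Ω} {W : Set ℝ → Ω → ℝ}

lemma IsWienerMeasure.enlarge_ae_eq (hW : IsWienerMeasure P W)
    {x : ℝ → Lp ℝ 2 (volume : Measure ℝ)} {X : Ω → C(ℝ, ℝ)}
    (hX : ∀ t, (fun ω => X ω t) =ᵐ[P] hW.isometry (x t)) (u H r t : ℝ) :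
    (fun ω => enlarge u H r (X ω) t) =ᵐ[P]
      hW.isometry ((r ^ H)⁻¹ • (x (u + r * t) - x u)) := by
  rw [map_smul, map_sub]
  filter_upwards [hX (u + r * t), hX u,
    Lp.coeFn_smul (r ^ H)⁻¹ (hW.isometry (x (u + r * t)) - hW.isometry (x u)),
    Lp.coeFn_sub (hW.isometry (x (u + r * t))) (hW.isometry (x u))] with ω h1 h2 h3 h4
  rw [h3, Pi.smul_apply, h4, Pi.sub_apply, ← h1, ← h2, smul_eq_mul, inv_mul_eq_div]
  rfl

/-- Polarisation: for processes vanishing at a common point, the variances of increments determine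
the covariance. -/
lemma inner_eq_of_norm_sub_eq {T E F : Type*} [NormedAddCommGroup E] [InnerProductSpace ℝ E]
    [NormedAddCommGroup F] [InnerProductSpace ℝ F] {x : T → E} {y : T → F} {o : T}
    (hx : x o = 0) (hy : y o = 0) (h : ∀ s t, ‖x s - x t‖ = ‖y s - y t‖) (s t : T) :
    inner ℝ (x s) (x t) = inner ℝ (y s) (y t) := by
  have h0 : ∀ t, ‖x t‖ = ‖y t‖ := fun t => by simpa [hx, hy] using h t o
  rw [real_inner_eq_norm_mul_self_add_norm_mul_self_sub_norm_sub_mul_self_div_two,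
    real_inner_eq_norm_mul_self_add_norm_mul_self_sub_norm_sub_mul_self_div_two, h0, h0, h]

/-- Fractional Brownian motion is self-similar with stationary increments: its enlargements have
the law of the process itself. -/
lemma IsWienerMeasure.map_enlarge_eq (hW : IsWienerMeasure P W) {H A : ℝ}
    (hH : H ∈ Set.Ioo (0 : ℝ) 1) {X : Ω → C(ℝ, ℝ)} (hXm : Measurable X)
    (hX : ∀ t, (fun ω => X ω t) =ᵐ[P] hW.isometry (mbmL2 (fun _ => H) (fun _ => A) t))
    (u : ℝ) {r : ℝ} (hr : 0 < r) : P.map (fun ω => enlarge u H r (X ω)) = P.map X := by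
  refine hW.map_eq_of_inner_eq (fun s t => ?_) ((measurable_enlarge u H r).comp hXm) hXm
    (hW.enlarge_ae_eq hX u H r) hX
  refine inner_eq_of_norm_sub_eq (o := (0 : ℝ))
    (x := fun t => (r ^ H)⁻¹ •
      (mbmL2 (fun _ => H) (fun _ => A) (u + r * t) - mbmL2 (fun _ => H) (fun _ => A) u))
    (y := mbmL2 (fun _ => H) (fun _ => A)) ?_ ?_ (fun s t => ?_) s t
  · simp
  · simp [mbmL2, kernelL2_zero_right]
  have hr' : 0 < r ^ H := Real.rpow_pos_of_pos hr _
  rw [← smul_sub, sub_sub_sub_cancel_right]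
  simp only [mbmL2]
  rw [← smul_sub, ← smul_sub, norm_smul, norm_smul, norm_smul, norm_kernelL2_sub hH,
    norm_kernelL2_sub hH, add_sub_add_left_eq_sub, ← mul_sub, abs_mul, abs_of_pos hr,
    Real.mul_rpow hr.le (abs_nonneg _), norm_inv, Real.norm_of_nonneg hr'.le]
  field_simp

/-- Multifractional Brownian motion with index and amplitude functions on the line is
localisable. -/
theorem IsWienerMeasure.exists_localisation [IsProbabilityMeasure P] (hW : IsWienerMeasure P W)
    {h a : ℝ → ℝ} {k l η u : ℝ} (hh : ∀ t, h t ∈ Set.Ioo (0 : ℝ) 1) (hu : h u < η)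
    (hk0 : 0 ≤ k) (hl0 : 0 ≤ l) (hk : ∀ s t, |h s - h t| ≤ k * |s - t| ^ η)
    (hl : ∀ s t, |a s - a t| ≤ l * |s - t| ^ η) :
    ∃ X X' : Ω → C(ℝ, ℝ), Measurable X ∧ Measurable X' ∧
      (∀ t, (fun ω => X ω t) =ᵐ[P] hW.isometry (mbmL2 h a t)) ∧
      (∀ t, (fun ω => X' ω t) =ᵐ[P] hW.isometry (mbmL2 (fun _ => h u) (fun _ => a u) t)) ∧
      TendstoInDistribution (fun r ω => enlarge u (h u) r (X ω)) (𝓝[>] (0 : ℝ)) X'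
        (fun _ => P) P := by
  have hη : 0 < η := (hh u).1.trans hu
  have hy := exists_norm_mbmL2_sub_le hη hh hk0 hl0 hk hl
  have hz := exists_norm_mbmL2_sub_le (h := fun _ => h u) (a := fun _ => a u) hη (fun _ => hh u)
    le_rfl le_rfl (by simp) (by simp)
  obtain ⟨X, hXm, hX⟩ := hW.exists_continuous_version hy
  obtain ⟨X', hXm', hX'⟩ := hW.exists_continuous_version hz
  refine ⟨X, X', hXm, hXm', hX, hX', ?_⟩
  set d : ℝ → Lp ℝ 2 (volume : Measure ℝ) := fun t =>
    mbmL2 h a t - mbmL2 (fun _ => h u) (fun _ => a u) t with hd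
  have hDm : Measurable fun ω => X ω - X' ω := measurable_of_measurable_eval fun t =>
    ((measurable_eval_CReal t).comp hXm).sub ((measurable_eval_CReal t).comp hXm')
  have hD : ∀ t, (fun ω => (X ω - X' ω) t) =ᵐ[P] hW.isometry (d t) := by
    intro t
    rw [hd, map_sub]
    filter_upwards [hX t, hX' t, Lp.coeFn_sub (hW.isometry (mbmL2 h a t))
      (hW.isometry (mbmL2 (fun _ => h u) (fun _ => a u) t))] with ω h1 h2 h3
    rw [h3, Pi.sub_apply, ← h1, ← h2, ContinuousMap.sub_apply]
  obtain ⟨N, hN⟩ := exists_nat_ge (|u| + 1)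
  have huN : u ∈ Set.Icc (-(N : ℝ)) N := abs_le.1 (by linarith)
  obtain ⟨C, hC, hd2⟩ := exists_norm_mbmL2_sub_fbm_le hη hh hk0 hl0 hk hl N huN
  have hd1 : ∃ κ γ : ℝ, 0 ≤ κ ∧ 0 < γ ∧ ∀ s ∈ Set.Icc (-(N : ℝ)) N,
      ∀ t ∈ Set.Icc (-(N : ℝ)) N, |s - t| ≤ 1 → ‖d s - d t‖ ≤ κ * |s - t| ^ γ := by
    obtain ⟨κ₁, γ₁, hκ₁, hγ₁, hy⟩ := hy N
    obtain ⟨κ₂, γ₂, hκ₂, hγ₂, hz⟩ := hz N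
    refine ⟨κ₁ + κ₂, min γ₁ γ₂, by positivity, lt_min hγ₁ hγ₂, fun s hs t ht hst => ?_⟩
    rcases eq_or_ne s t with rfl | hne
    · rw [sub_self, norm_zero]; positivity
    have hpos : 0 < |s - t| := abs_pos.2 (sub_ne_zero.2 hne)
    have e1 : |s - t| ^ γ₁ ≤ |s - t| ^ min γ₁ γ₂ :=
      Real.rpow_le_rpow_of_exponent_ge hpos hst (min_le_left _ _)
    have e2 : |s - t| ^ γ₂ ≤ |s - t| ^ min γ₁ γ₂ :=
      Real.rpow_le_rpow_of_exponent_ge hpos hst (min_le_right _ _)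
    calc ‖d s - d t‖ = _ := by rw [hd]; dsimp only; rw [sub_sub_sub_comm]
      _ ≤ _ := norm_sub_le _ _
      _ ≤ _ := add_le_add (hy s hs t ht hst) (hz s hs t ht hst)
      _ ≤ κ₁ * |s - t| ^ min γ₁ γ₂ + κ₂ * |s - t| ^ min γ₁ γ₂ := by gcongr
      _ = _ := by ring
  obtain ⟨κ, γ, hκ, hγ, hd1⟩ := hd1
  refine tendstoInDistribution_add_of_map_eq (Y := fun r ω => enlarge u (h u) r (X' ω))
    (V := fun r ω => enlarge u (h u) r (X ω - X' ω))
    (fun r => (measurable_enlarge _ _ _).comp hXm) (fun r => (measurable_enlarge _ _ _).comp hXm')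
    (fun r => (measurable_enlarge _ _ _).comp hDm) hXm' (fun r ω => ?_) ?_ fun M δ hδ => ?_
  · ext t
    simp only [enlarge, ContinuousMap.coe_mk, ContinuousMap.add_apply, ContinuousMap.sub_apply]
    ring
  · filter_upwards [self_mem_nhdsWithin] with r hr
    exact hW.map_enlarge_eq (hh u) hXm' hX' u hr
  · obtain ⟨K, ρ, γ', hK, hρ, hγ', hV⟩ :=
      exists_norm_enlarge_sub_le (hh u).1 hu hκ hγ hC hN hd1 hd2 M
    obtain ⟨p, hp⟩ := exists_nat_ge (2 / γ')
    rw [div_le_iff₀' hγ'] at hp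
    have hp0 : p ≠ 0 := by
      rintro rfl
      norm_num at hp
    obtain ⟨C', hC', hmax⟩ := exists_measure_abs_gt_le (P := P) M p hp0 hδ
    have hlim : Tendsto (fun r : ℝ => gaussianMoment p * ENNReal.ofReal ((K * r ^ ρ) ^ p) * C')
        (𝓝[>] 0) (𝓝 (gaussianMoment p * ENNReal.ofReal ((K * 0 ^ ρ) ^ p) * C')) := by
      refine ENNReal.Tendsto.mul_const (ENNReal.Tendsto.const_mul (ENNReal.tendsto_ofReal ?_)
        (Or.inr (gaussianMoment_ne_top p))) (Or.inr hC')
      have hcont : Continuous fun r : ℝ => (K * r ^ ρ) ^ p :=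
        (continuous_const.mul (continuous_id.rpow_const fun _ => Or.inr hρ.le)).pow p
      exact (hcont.tendsto 0).mono_left nhdsWithin_le_nhds
    rw [Real.zero_rpow hρ.ne', mul_zero, zero_pow hp0, ENNReal.ofReal_zero, mul_zero, zero_mul]
      at hlim
    refine tendsto_of_tendsto_of_tendsto_of_le_of_le' tendsto_const_nhds hlim
      (Eventually.of_forall fun _ => zero_le) ?_
    -- For `r ≤ 1 / (M + 1)` both `r ≤ 1` and `r M ≤ 1`, so the enlarged times stay in `[-N, N]`.
    have hM1 : (0 : ℝ) < ((M : ℝ) + 1)⁻¹ := by positivity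
    filter_upwards [Ioc_mem_nhdsGT hM1] with r hr
    have hrM : r * (M + 1) ≤ 1 := by
      rw [← le_div_iff₀ (by positivity), one_div]; exact hr.2
    have hr1 : r ≤ 1 := by nlinarith [hr.1, M.cast_nonneg (α := ℝ)]
    have hrM' : r * M ≤ 1 := by nlinarith [hr.1]
    refine hmax ((measurable_enlarge _ _ _).comp hDm) (fun ω => ?_)
      (hW.incrementMomentLE (hW.enlarge_ae_eq hD u (h u) r)
        (mul_nonneg hK (Real.rpow_nonneg hr.1.le _)) hp (hV r hr.1 hr1 hrM'))
    simp [enlarge]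

lemma exists_holder_comp_retraction {f π : ℝ → ℝ} {U : Set ℝ} {η : ℝ≥0}
    (hf : ∃ k : ℝ≥0, HolderOnWith k η f U) (hπU : ∀ t, π t ∈ U)
    (hπ : ∀ s t, |π s - π t| ≤ |s - t|) :
    ∃ k : ℝ, 0 ≤ k ∧ ∀ s t, |f (π s) - f (π t)| ≤ k * |s - t| ^ (η : ℝ) := by
  obtain ⟨k, hk⟩ := hf
  refine ⟨k, k.coe_nonneg, fun s t => ?_⟩
  have h1 := hk.dist_le (hπU s) (hπU t)
  simp only [Real.dist_eq] at h1
  exact h1.trans (mul_le_mul_of_nonneg_left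
    (Real.rpow_le_rpow (abs_nonneg _) (hπ s t) η.coe_nonneg) k.coe_nonneg)

lemma IsWienerMeasure.mbm_ae_eq (hW : IsWienerMeasure P W) {h a : ℝ → ℝ} {t : ℝ}
    (ht : h t ∈ Set.Ioo (0 : ℝ) 1) : mbm P W h a t =ᵐ[P] hW.isometry (mbmL2 h a t) := by
  rw [mbmL2, map_smul, kernelL2_eq ht]
  filter_upwards [hW.wienerIntegral_ae_eq (memLp_mvnKernel ht t), Lp.coeFn_smul (a t)
    (hW.isometry ((memLp_mvnKernel ht t).toLp _))] with ω h1 h2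
  rw [h2, Pi.smul_apply, ← h1, smul_eq_mul, mbm]

end Localisation

end

/-! ### The theorem on a closed interval. -/

theorem theorem6p1 {Ω : Type*} [MeasurableSpace Ω] (P : Measure Ω) [IsProbabilityMeasure P]
    (W : Set ℝ → Ω → ℝ) (hW : IsWienerMeasure P W)
    (U : Set ℝ) (hUc : IsClosed U) (hUi : U.OrdConnected) (u : ℝ) (hu : u ∈ interior U)
    (h a : ℝ → ℝ) (hh : ∀ t ∈ U, h t ∈ Set.Ioo (0 : ℝ) 1) (ha : ∀ t ∈ U, 0 < a t)
    (η : ℝ≥0) (hη : h u < η) (hη1 : η ≤ 1)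
    (hhη : ∃ k : ℝ≥0, HolderOnWith k η h U) (haη : ∃ k : ℝ≥0, HolderOnWith k η a U) :
    StronglyLocalisableAt P P U (mbm P W h a) (h u) u
      (fun t ω => a u * fbmConst (h u) * fbm P W (h u) t ω) := by
  have huU : u ∈ U := interior_subset hu
  have hH := hh u huU
  have hc := fbmConst_pos hH
  obtain ⟨π, hπU, hπid, hπ⟩ := exists_lipschitz_retraction hUc hUi ⟨u, huU⟩
  obtain ⟨k, hk0, hk⟩ := exists_holder_comp_retraction hhη hπU hπ
  obtain ⟨l, hl0, hl⟩ := exists_holder_comp_retraction haη hπU hπ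
  have hform : (fun (t : ℝ) (ω : Ω) => a u * fbmConst (h u) * fbm P W (h u) t ω) =
      mbm P W (fun _ => h u) (fun _ => a u) := by
    ext t ω
    rw [fbm, mbm]
    field_simp
  have hZ (t : ℝ) := hW.mbm_ae_eq (h := fun _ => h u) (a := fun _ => a u) (t := t) hH
  -- The process with retracted index and amplitude agrees with the given one on `U` and supplies
  -- the values of the paths off `U`.
  obtain ⟨X, X', hXm, hXm', hX, hX', hlim⟩ := hW.exists_localisation (h := fun t => h (π t))
    (a := fun t => a (π t)) (u := u) (η := η) (fun t => hh _ (hπU t)) (by rwa [hπid u huU]) hk0 hl0 hk hl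
  simp only [hπid u huU] at hX' hlim
  rw [hform]
  refine ⟨⟨1, fun h1 => ?_⟩, X, X', ⟨hXm, fun t ht => ?_⟩, ⟨hXm', fun t _ => ?_⟩, hlim⟩
  · have h2 : hW.isometry (mbmL2 (fun _ => h u) (fun _ => a u) 1) = 0 :=
      (Lp.eq_zero_iff_ae_eq_zero).2 ((hZ 1).symm.trans h1)
    rw [← norm_eq_zero, hW.norm_isometry, mbmL2, norm_smul, norm_kernelL2_one hH] at h2
    exact (mul_pos (norm_pos_iff.2 (ha u huU).ne') hc).ne' h2
  · refine (hX t).trans ?_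
    have : mbmL2 (fun t => h (π t)) (fun t => a (π t)) t = mbmL2 h a t := by
      simp only [mbmL2, hπid t ht]
    rw [this]
    exact (hW.mbm_ae_eq (hh t ht)).symm
  · exact (hX' t).trans (hZ t).symm
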